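/- Let $R$ be a commutative ring in which $2$ is invertible and let $X$ be a finite set. A \emph{graph} with boundary $X$ is a finite graph whose vertices are univalent or trivalent, whose univalent vertices are labelled bijectively by $X$, and whose trivalent vertices each carry a cyclic order of the three incident half-edges; components that are circles without vertices are allowed, and a graph need not be connected. Let $\mathcal{G}(X)$ be the set of isomorphism classes (relative to $X$) of such graphs, and let $\widetilde{\mathcal{D}}(X)$ be the quotient of the free $R[\delta]$-module on $\mathcal{G}(X)$ by the antisymmetry (AS) relation, the Jacobi (IHX) relation, and the relation that removing a circle component multiplies by $\delta$. The symmetric group $\mathfrak{S}_3$ acts on $\widetilde{\mathcal{D}}([3])$ by permuting the boundary points; let $$\Lambda=\{T\in\widetilde{\mathcal{D}}([3]) \mid \sigma T=\varepsilon(\sigma)T \text{ for all } \sigma\in\mathfrak{S}_3\},$$ where $\varepsilon$ is the sign character. Let $D$ be a graph with boundary $X$. For a trivalent vertex $v$ of $D$ and a bijection $\pi$ from $[3]$ to the set of half-edges at $v$, removing $v$ and glueing the leg $i$ of a graph $T$ with boundary $[3]$ to the half-edge $\pi(i)$, for each $i\in[3]$, defines an $R[\delta]$-linear map $\psi(D,v,\pi)\colon\widetilde{\mathcal{D}}([3])\to\widetilde{\mathcal{D}}(X)$.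 Then: (1) the restriction of $\psi(D,v,\pi)$ to $\Lambda$ is the same for all $\pi$ that are compatible with the cyclic order at $v$; denote it by $\psi(D,v)\colon\Lambda\to\widetilde{\mathcal{D}}(X)$; (2) if the trivalent vertices $u$ and $v$ of $D$ are connected by an edge, then $\psi(D,v)=\psi(D,u)$; (3) more generally, $\psi(D,v)=\psi(D,u)$ whenever $u$ and $v$ are trivalent vertices in the same connected component of $D$. -/

import Mathlib

namespace Jacobi

/-- Every orbit of the permutation `s` has order two or three. -/
def HasSmallOrbits {α : Type*} (s : Equiv.Perm α) : Prop :=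
  ∀ x, s x ≠ x ∧ (s (s x) = x ∨ s (s (s x)) = x)

theorem HasSmallOrbits.sumCongr {α β : Type*} {s : Equiv.Perm α} {t : Equiv.Perm β}
    (hs : HasSmallOrbits s) (ht : HasSmallOrbits t) :
    HasSmallOrbits (Equiv.Perm.sumCongr s t) := by
  rintro (x | x)
  · simpa using hs x
  · simpa using ht x

theorem HasSmallOrbits.permCongr {α β : Type*} {s : Equiv.Perm α}
    (hs : HasSmallOrbits s) (E : α ≃ β) : HasSmallOrbits (E.permCongr s) := by
  intro x
  obtain ⟨h1, h2⟩ := hs (E.symm x)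
  simp only [Equiv.permCongr_apply, Equiv.symm_apply_apply]
  refine ⟨fun h => h1 (E.injective (by rw [h, Equiv.apply_symm_apply])), ?_⟩
  rcases h2 with h | h
  · exact Or.inl (by rw [h, Equiv.apply_symm_apply])
  · exact Or.inr (by rw [h, Equiv.apply_symm_apply])

open Classical in
/-- The transposition of `a` and `b`. -/
noncomputable def exchange {α : Type*} (a b : α) : Equiv.Perm α := Equiv.swap a b

theorem exchange_eq_swap {α : Type*} [DecidableEq α] (a b : α) :
    exchange a b = Equiv.swap a b := by
  unfold exchange
  congr!

theorem exchange_inv {α : Type*} (a b : α) : (exchange a b)⁻¹ = exchange a b := by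
  simp [exchange]

theorem map_exchange {α β : Type*} {f : α → β} (hf : Function.Injective f) (a b x : α) :
    f (exchange a b x) = exchange (f a) (f b) (f x) := by
  classical
  rw [exchange_eq_swap, exchange_eq_swap, hf.swap_apply]

theorem permCongr_exchange {α β : Type*} (E : α ≃ β) (a b : α) :
    E.permCongr (exchange a b) = exchange (E a) (E b) := by
  ext x
  obtain ⟨y, rfl⟩ := E.surjective x
  rw [Equiv.permCongr_apply, Equiv.symm_apply_apply, map_exchange E.injective]

theorem sumCongr_exchange {α β : Type*} (a b : β) :
    Equiv.Perm.sumCongr (1 : Equiv.Perm α) (exchange a b) =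
      exchange (Sum.inr a) (Sum.inr b) := by
  classical
  rw [exchange_eq_swap, exchange_eq_swap]
  exact Equiv.Perm.sumCongr_one_swap a b

/-- A pre-graph with set of univalent vertices (boundary) `X`.  Its half-edges are the elements of
`X ⊕ F`; the orbits of `σ` are the bivalent vertices and the trivalent vertices with a cyclic
order of their three half-edges; the involution `e` joins the half-edges in `F` in pairs, and a
half-edge `x` in `X` ends at the univalent vertex labelled by `x`. -/
structure PreGraph (X : Type*) where
  F : Type
  finite_F : Finite F
  e : Equiv.Perm F
  e_e : ∀ f, e (e f) = f
  e_ne : ∀ f, e f ≠ f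
  σ : Equiv.Perm (X ⊕ F)
  orbits : HasSmallOrbits σ

namespace PreGraph

variable {X Y : Type*}

/-- A pre-graph is a graph if each bivalent vertex `{x, y}` is either contained in `X`
(an interval component joining two boundary points) or is an orbit of `e` (a circle component). -/
def IsGraph (P : PreGraph X) : Prop :=
  ∀ x, P.σ (P.σ x) = x →
    ((∃ a b : X, x = Sum.inl a ∧ P.σ x = Sum.inl b) ∨
      ∃ f : P.F, x = Sum.inr f ∧ P.σ x = Sum.inr (P.e f))

/-- Isomorphism of pre-graphs, the identity on the boundary. -/
def Iso (P Q : PreGraph X) : Prop :=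
  ∃ f : P.F ≃ Q.F, (∀ x, f (P.e x) = Q.e (f x)) ∧
    ∀ x, Sum.map id f (P.σ x) = Q.σ (Sum.map id f x)

/-- Rearrange the half-edges at the vertices: `τ x` takes the place of `x`.
The pairing of half-edges does not change. -/
def rearrange (P : PreGraph X) (τ : Equiv.Perm (X ⊕ P.F)) : PreGraph X where
  F := P.F
  finite_F := P.finite_F
  e := P.e
  e_e := P.e_e
  e_ne := P.e_ne
  σ := τ * P.σ * τ⁻¹
  orbits := P.orbits.permCongr τ

/-- Disjoint union with a circle. -/
def addCircle (P : PreGraph X) : PreGraph X where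
  F := P.F ⊕ Bool
  finite_F := by
    have := P.finite_F
    infer_instance
  e := Equiv.Perm.sumCongr P.e Equiv.boolNot
  e_e := by rintro (f | b) <;> simp [P.e_e]
  e_ne := by
    rintro (f | b)
    · simpa using P.e_ne f
    · cases b <;> simp
  σ := (Equiv.sumAssoc X P.F Bool).permCongr (Equiv.Perm.sumCongr P.σ Equiv.boolNot)
  orbits := (P.orbits.sumCongr (fun b => by cases b <;> simp)).permCongr _

/-- A half-edge of `P` as a half-edge of `P.addCircle`. -/
def old (P : PreGraph X) (a : X ⊕ P.F) : X ⊕ P.addCircle.F := Sum.map id Sum.inl a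

/-- The half-edges of the new circle of `P.addCircle`. -/
def new (P : PreGraph X) (b : Bool) : X ⊕ P.addCircle.F := Sum.inr (Sum.inr b)

/-- Put a bivalent vertex on the edge of the half-edge `a`.  There are two new half-edges `p` and
`q`, joined by `e`; `p` takes the place of `a` at its vertex, and `{a, q}` is the new bivalent
vertex.  (This is a circle with half-edges `p`, `q` added, and then `a` and `p` exchanged.)
The reduction of a pre-graph is the inverse of this. -/
noncomputable def subdivide (P : PreGraph X) (a : X ⊕ P.F) : PreGraph X :=
  P.addCircle.rearrange (exchange (P.old a) (P.new false))

/-- Reverse the cyclic order at the (trivalent) vertex of the half-edge `x`. -/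
noncomputable def flip (P : PreGraph X) (x : X ⊕ P.F) : PreGraph X :=
  P.rearrange (exchange x (P.σ x))

/-- Let the edge of `h` join the vertices with cyclically ordered half-edges `(h, a, b)` and
`(e h, c, d)`.  This is the permutation `a ↦ b ↦ c ↦ a`. -/
noncomputable def jacobiCycle (P : PreGraph X) (h : P.F) : Equiv.Perm (X ⊕ P.F) :=
  exchange (P.σ (Sum.inr h)) (P.σ (P.σ (Sum.inr h))) *
    exchange (P.σ (P.σ (Sum.inr h))) (P.σ (Sum.inr (P.e h)))

/-- The half-edge `x` is at a trivalent vertex. -/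
def IsTrivalentAt (P : PreGraph X) (x : X ⊕ P.F) : Prop := P.σ (P.σ x) ≠ x

/-- The edge of `h` joins two different trivalent vertices. -/
def IsInnerEdge (P : PreGraph X) (h : P.F) : Prop :=
  P.IsTrivalentAt (Sum.inr h) ∧ P.IsTrivalentAt (Sum.inr (P.e h)) ∧
    P.σ (Sum.inr h) ≠ Sum.inr (P.e h) ∧ P.σ (P.σ (Sum.inr h)) ≠ Sum.inr (P.e h)

/-- Relabel the boundary along a bijection. -/
def relabel (φ : X ≃ Y) (P : PreGraph X) : PreGraph Y where
  F := P.F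
  finite_F := P.finite_F
  e := P.e
  e_e := P.e_e
  e_ne := P.e_ne
  σ := (Equiv.sumCongr φ (Equiv.refl P.F)).permCongr P.σ
  orbits := P.orbits.permCongr _

/-- A trivalent vertex: an orbit of `σ` with three elements. -/
structure Vertex (D : PreGraph X) where
  carrier : Set (X ⊕ D.F)
  isOrbit : ∃ x, D.IsTrivalentAt x ∧ carrier = {x, D.σ x, D.σ (D.σ x)}

/-- A numbering of the half-edges at `v` agrees with the cyclic order at `v`. -/
def Vertex.IsCyclic {D : PreGraph X} (v : D.Vertex) (π : Fin 3 ≃ v.carrier) : Prop :=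
  ∀ i, D.σ (π i) = π (i + 1)

/-- The vertices `u` and `v` are connected by an edge. -/
def Vertex.Adjacent {D : PreGraph X} (u v : D.Vertex) : Prop :=
  ∃ f : D.F, Sum.inr f ∈ u.carrier ∧ Sum.inr (D.e f) ∈ v.carrier

/-- Two half-edges are in the same connected component: the equivalence relation generated by
`x ∼ σ x` and `f ∼ e f`. -/
def Connected (D : PreGraph X) : X ⊕ D.F → X ⊕ D.F → Prop :=
  Relation.EqvGen fun x y => y = D.σ x ∨ ∃ f : D.F, x = Sum.inr f ∧ y = Sum.inr (D.e f)

/-- The vertices `u` and `v` are in the same connected component. -/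
def Vertex.SameComponent {D : PreGraph X} (u v : D.Vertex) : Prop :=
  ∃ x ∈ u.carrier, ∃ y ∈ v.carrier, D.Connected x y

theorem Vertex.mem_iff {D : PreGraph X} (v : D.Vertex) (x : X ⊕ D.F) :
    D.σ x ∉ v.carrier ↔ x ∉ v.carrier := by
  obtain ⟨y, hy, hv⟩ := v.isOrbit
  have h3 : D.σ (D.σ (D.σ y)) = y := (D.orbits y).2.resolve_left hy
  rw [not_iff_not, hv]
  simp only [Set.mem_insert_iff, Set.mem_singleton_iff, EmbeddingLike.apply_eq_iff_eq]
  constructor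
  · rintro (h | h | h)
    · right; right
      apply D.σ.injective
      rw [h, h3]
    · exact Or.inl h
    · exact Or.inr (Or.inl h)
  · rintro (h | h | h)
    · exact Or.inr (Or.inl h)
    · exact Or.inr (Or.inr h)
    · left; rw [h, h3]

/-- The permutation `σ` on the half-edges which remain when the vertex `v` is removed. -/
def Vertex.rest {D : PreGraph X} (v : D.Vertex) : Equiv.Perm {x : X ⊕ D.F // x ∉ v.carrier} :=
  D.σ.subtypePerm v.mem_iff

theorem Vertex.rest_orbits {D : PreGraph X} (v : D.Vertex) : HasSmallOrbits v.rest := by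
  rintro ⟨x, hx⟩
  simpa [Vertex.rest, Subtype.ext_iff] using D.orbits x

open Classical in
/-- The half-edges of `D`: those away from `v`, and the three at `v`, numbered by `π`. -/
noncomputable def Vertex.split {D : PreGraph X} (v : D.Vertex) (π : Fin 3 ≃ v.carrier) :
    {x : X ⊕ D.F // x ∉ v.carrier} ⊕ Fin 3 ≃ X ⊕ D.F :=
  ((Equiv.sumComm _ _).trans (Equiv.sumCongr π (Equiv.refl _))).trans
    (Equiv.sumCompl fun x => x ∈ v.carrier)

/-- The half-edges of `D` with `v` replaced by a pre-graph with three legs and internal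
half-edges `F`: the leg `i` is identified with the half-edge `π i`. -/
noncomputable def Vertex.glue {D : PreGraph X} (v : D.Vertex) (π : Fin 3 ≃ v.carrier) (F : Type) :
    {x : X ⊕ D.F // x ∉ v.carrier} ⊕ (Fin 3 ⊕ F) ≃ X ⊕ (D.F ⊕ F) :=
  ((Equiv.sumAssoc _ _ _).symm.trans (Equiv.sumCongr (v.split π) (Equiv.refl F))).trans
    (Equiv.sumAssoc _ _ _)

/-- Remove the vertex `v` from `D` and glue in the pre-graph `T` with three legs, the leg `i` of
`T` being glued to the half-edge `π i` at `v`. -/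
noncomputable def plug {D : PreGraph X} (v : D.Vertex) (π : Fin 3 ≃ v.carrier)
    (T : PreGraph (Fin 3)) : PreGraph X where
  F := D.F ⊕ T.F
  finite_F := by
    have := D.finite_F
    have := T.finite_F
    infer_instance
  e := Equiv.Perm.sumCongr D.e T.e
  e_e := by rintro (f | f) <;> simp [D.e_e, T.e_e]
  e_ne := by
    rintro (f | f)
    · simpa using D.e_ne f
    · simpa using T.e_ne f
  σ := (v.glue π T.F).permCongr (Equiv.Perm.sumCongr v.rest T.σ)
  orbits := (v.rest_orbits.sumCongr T.orbits).permCongr _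

/-! The constructions are compatible with isomorphisms, rearrangements and circles. -/

theorem mk_congr {F : Type} {hF : Finite F} {e : Equiv.Perm F} {h₁ : ∀ f, e (e f) = f}
    {h₂ : ∀ f, e f ≠ f} {s t : Equiv.Perm (X ⊕ F)} {hs : HasSmallOrbits s}
    {ht : HasSmallOrbits t} (h : s = t) :
    PreGraph.mk F hF e h₁ h₂ s hs = PreGraph.mk F hF e h₁ h₂ t ht := by
  subst h
  rfl

theorem addCircle_σ_old (P : PreGraph X) (a : X ⊕ P.F) :
    P.addCircle.σ (P.old a) = P.old (P.σ a) := by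
  have h : ∀ z : X ⊕ P.F, P.old z = Equiv.sumAssoc X P.F Bool (Sum.inl z) := by
    rintro (z | z) <;> rfl
  rw [h a, h (P.σ a)]
  exact (congrArg (fun y => Equiv.sumAssoc X P.F Bool (Equiv.Perm.sumCongr P.σ Equiv.boolNot y))
    (Equiv.symm_apply_apply _ _)).trans rfl

theorem addCircle_σ_new (P : PreGraph X) (b : Bool) :
    P.addCircle.σ (P.new b) = P.new (!b) := rfl

theorem old_or_new (P : PreGraph X) (x : X ⊕ P.addCircle.F) :
    (∃ a, x = P.old a) ∨ ∃ b, x = P.new b := by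
  rcases x with x | x | x
  · exact Or.inl ⟨Sum.inl x, rfl⟩
  · exact Or.inl ⟨Sum.inr x, rfl⟩
  · exact Or.inr ⟨x, rfl⟩

theorem rearrange_iso {P Q : PreGraph X} (f : P.F ≃ Q.F) (he : ∀ x, f (P.e x) = Q.e (f x))
    (hσ : ∀ x, Sum.map id f (P.σ x) = Q.σ (Sum.map id f x)) (a b : X ⊕ P.F) :
    (P.rearrange (exchange a b)).Iso
      (Q.rearrange (exchange (Sum.map id f a) (Sum.map id f b))) := by
  have hinj : Function.Injective (Sum.map (id : X → X) f) :=
    Function.Injective.sumMap Function.injective_id f.injective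
  have key : ∀ x : X ⊕ P.F, Sum.map id f ((exchange a b * P.σ * (exchange a b)⁻¹) x) =
      (exchange (Sum.map id f a) (Sum.map id f b) * Q.σ *
        (exchange (Sum.map id f a) (Sum.map id f b))⁻¹) (Sum.map id f x) := by
    intro x
    simp only [Equiv.Perm.mul_apply, exchange_inv]
    rw [map_exchange hinj, hσ, map_exchange hinj]
  exact ⟨f, he, key⟩

/-- A construction on pre-graphs that keeps all half-edges and is compatible with all changes of
the vertices. -/
structure Local (Φ : PreGraph Y → PreGraph X) where
  k : ∀ P : PreGraph Y, P.F → (Φ P).F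
  j : ∀ P : PreGraph Y, Y ⊕ P.F → X ⊕ (Φ P).F
  lift : ∀ P : PreGraph Y, Equiv.Perm (Y ⊕ P.F) →* Equiv.Perm (X ⊕ (Φ P).F)
  j_inr : ∀ P f, j P (Sum.inr f) = Sum.inr (k P f)
  j_inj : ∀ P, Function.Injective (j P)
  e_k : ∀ P f, (Φ P).e (k P f) = k P (P.e f)
  σ_j : ∀ P x, (Φ P).σ (j P x) = j P (P.σ x)
  lift_exchange : ∀ P (a b : Y ⊕ P.F), lift P (exchange a b) = exchange (j P a) (j P b)
  rearrange : ∀ P τ, Φ (P.rearrange τ) = (Φ P).rearrange (lift P τ)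
  iso : ∀ P Q, P.Iso Q → (Φ P).Iso (Φ Q)
  c : ∀ P, (Φ P.addCircle).F ≃ (Φ P).addCircle.F
  c_e : ∀ P x, c P ((Φ P.addCircle).e x) = (Φ P).addCircle.e (c P x)
  c_σ : ∀ P x, Sum.map id (c P) ((Φ P.addCircle).σ x) = (Φ P).addCircle.σ (Sum.map id (c P) x)
  c_old : ∀ P a, Sum.map id (c P) (j P.addCircle (P.old a)) = (Φ P).old (j P a)
  c_new : ∀ P b, Sum.map id (c P) (j P.addCircle (P.new b)) = (Φ P).new b

namespace Local

variable {Φ : PreGraph Y → PreGraph X}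

theorem subdivide (L : Local Φ) (P : PreGraph Y) (a : Y ⊕ P.F) :
    (Φ (P.subdivide a)).Iso ((Φ P).subdivide (L.j P a)) := by
  have h := rearrange_iso (L.c P) (L.c_e P) (L.c_σ P) (L.j _ (P.old a)) (L.j _ (P.new false))
  rw [L.c_old, L.c_new] at h
  unfold PreGraph.subdivide
  rw [L.rearrange, L.lift_exchange]
  exact h

theorem circle (L : Local Φ) (P : PreGraph Y) : (Φ P.addCircle).Iso (Φ P).addCircle :=
  ⟨L.c P, L.c_e P, L.c_σ P⟩

theorem trivalent (L : Local Φ) (P : PreGraph Y) (x : Y ⊕ P.F) (h : P.IsTrivalentAt x) :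
    (Φ P).IsTrivalentAt (L.j P x) := by
  unfold IsTrivalentAt at *
  rw [L.σ_j, L.σ_j]
  exact fun h' => h (L.j_inj P h')

theorem flip (L : Local Φ) (P : PreGraph Y) (x : Y ⊕ P.F) :
    Φ (P.flip x) = (Φ P).flip (L.j P x) := by
  unfold PreGraph.flip
  rw [L.rearrange, L.lift_exchange, L.σ_j]

theorem inner (L : Local Φ) (P : PreGraph Y) (h : P.F) (hh : P.IsInnerEdge h) :
    (Φ P).IsInnerEdge (L.k P h) := by
  obtain ⟨h1, h2, h3, h4⟩ := hh
  have h1' := L.trivalent P _ h1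
  have h2' := L.trivalent P _ h2
  rw [L.j_inr] at h1' h2'
  refine ⟨h1', by rwa [L.e_k], ?_, ?_⟩
  · rw [L.e_k, ← L.j_inr, ← L.j_inr, L.σ_j]
    exact fun h' => h3 (L.j_inj P h')
  · rw [L.e_k, ← L.j_inr, ← L.j_inr, L.σ_j, L.σ_j]
    exact fun h' => h4 (L.j_inj P h')

theorem jacobiCycle (L : Local Φ) (P : PreGraph Y) (h : P.F) :
    L.lift P (P.jacobiCycle h) = (Φ P).jacobiCycle (L.k P h) := by
  unfold PreGraph.jacobiCycle
  rw [map_mul, L.lift_exchange, L.lift_exchange, L.e_k, ← L.j_inr, ← L.j_inr, L.σ_j, L.σ_j, L.σ_j]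

end Local

theorem relabel_rearrange (φ : X ≃ Y) (P : PreGraph X) (τ : Equiv.Perm (X ⊕ P.F)) :
    (P.rearrange τ).relabel φ =
      (P.relabel φ).rearrange ((Equiv.sumCongr φ (Equiv.refl P.F)).permCongrHom τ) := by
  have key : (Equiv.sumCongr φ (Equiv.refl P.F)).permCongrHom (τ * P.σ * τ⁻¹) =
      (Equiv.sumCongr φ (Equiv.refl P.F)).permCongrHom τ *
        (Equiv.sumCongr φ (Equiv.refl P.F)).permCongrHom P.σ *
        ((Equiv.sumCongr φ (Equiv.refl P.F)).permCongrHom τ)⁻¹ := by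
    rw [map_mul, map_mul, map_inv]
  exact mk_congr key

/-- A half-edge of `P` as a half-edge of `P.relabel φ`. -/
def relabelHalfEdge (φ : X ≃ Y) (P : PreGraph X) : X ⊕ P.F ≃ Y ⊕ (P.relabel φ).F :=
  Equiv.sumCongr φ (Equiv.refl P.F)

theorem relabel_σ (φ : X ≃ Y) (P : PreGraph X) (x : X ⊕ P.F) :
    (P.relabel φ).σ (relabelHalfEdge φ P x) = relabelHalfEdge φ P (P.σ x) :=
  congrArg (fun y => relabelHalfEdge φ P (P.σ y)) (Equiv.symm_apply_apply (relabelHalfEdge φ P) x)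

/-- Relabelling is compatible with all changes of the vertices. -/
noncomputable def relabelLocal (φ : X ≃ Y) : Local (relabel φ) where
  k P f := f
  j P := relabelHalfEdge φ P
  lift P := (Equiv.sumCongr φ (Equiv.refl P.F)).permCongrHom.toMonoidHom
  j_inr P f := rfl
  j_inj P := (relabelHalfEdge φ P).injective
  e_k P f := rfl
  σ_j P x := relabel_σ φ P x
  lift_exchange P a b := permCongr_exchange (relabelHalfEdge φ P) a b
  rearrange P τ := relabel_rearrange φ P τ
  iso P Q := by
    rintro ⟨f, he, hσ⟩
    refine ⟨f, he, fun x => ?_⟩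
    obtain ⟨y, rfl⟩ := (relabelHalfEdge φ P).surjective x
    have h : ∀ z : X ⊕ P.F, Sum.map (id : Y → Y) f (relabelHalfEdge φ P z) =
        relabelHalfEdge φ Q (Sum.map id f z) := by
      rintro (z | z) <;> rfl
    refine (congrArg (Sum.map (id : Y → Y) f) (relabel_σ φ P y)).trans ((h _).trans ?_)
    refine Eq.trans ?_ (congrArg _ (h y).symm)
    rw [hσ, relabel_σ φ Q]
  c P := Equiv.refl _
  c_e P x := rfl
  c_σ P x := by
    have hid : ∀ z : Y ⊕ (P.addCircle.relabel φ).F,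
        (Sum.map id (Equiv.refl (P.addCircle.relabel φ).F) z : Y ⊕ (P.relabel φ).addCircle.F) =
          z := by
      rintro (z | z) <;> rfl
    have h : ∀ z, (relabelHalfEdge φ P.addCircle (P.old z) : Y ⊕ (P.relabel φ).addCircle.F) =
        (P.relabel φ).old (relabelHalfEdge φ P z) := by
      rintro (z | z) <;> rfl
    obtain ⟨y, rfl⟩ := (relabelHalfEdge φ P.addCircle).surjective x
    refine (hid _).trans (Eq.trans ?_ (congrArg _ (hid _).symm))
    refine (relabel_σ φ P.addCircle y).trans ?_
    rcases P.old_or_new y with ⟨a, rfl⟩ | ⟨b, rfl⟩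
    · rw [addCircle_σ_old]
      refine (h _).trans (Eq.trans ?_ (congrArg _ (h _).symm))
      rw [addCircle_σ_old, relabel_σ]
    · rfl
  c_old P a := by rcases a with a | a <;> rfl
  c_new P b := rfl

theorem plug_σ {D : PreGraph X} (v : D.Vertex) (π : Fin 3 ≃ v.carrier) (T : PreGraph (Fin 3))
    (x : {x : X ⊕ D.F // x ∉ v.carrier} ⊕ (Fin 3 ⊕ T.F)) :
    (plug v π T).σ (v.glue π T.F x) = v.glue π T.F (Sum.map v.rest T.σ x) := by
  exact (congrArg (fun y => v.glue π T.F (Equiv.Perm.sumCongr v.rest T.σ y))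
    (Equiv.symm_apply_apply _ x)).trans rfl

theorem plug_rearrange {D : PreGraph X} (v : D.Vertex) (π : Fin 3 ≃ v.carrier)
    (T : PreGraph (Fin 3)) (τ : Equiv.Perm (Fin 3 ⊕ T.F)) :
    plug v π (T.rearrange τ) = (plug v π T).rearrange
      ((v.glue π T.F).permCongrHom (Equiv.Perm.sumCongrHom _ _ (1, τ))) := by
  have key : (v.glue π T.F).permCongrHom
        (Equiv.Perm.sumCongrHom _ _ (v.rest, τ * T.σ * τ⁻¹)) =
      (v.glue π T.F).permCongrHom (Equiv.Perm.sumCongrHom _ _ (1, τ)) *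
        (v.glue π T.F).permCongrHom (Equiv.Perm.sumCongrHom _ _ (v.rest, T.σ)) *
        ((v.glue π T.F).permCongrHom (Equiv.Perm.sumCongrHom _ _ (1, τ)))⁻¹ := by
    rw [← map_inv, ← map_mul, ← map_mul, ← map_inv, ← map_mul, ← map_mul]
    simp
  exact mk_congr key

theorem glue_map {D : PreGraph X} (v : D.Vertex) (π : Fin 3 ≃ v.carrier) {F G : Type}
    (f : F → G) (x : {x : X ⊕ D.F // x ∉ v.carrier} ⊕ (Fin 3 ⊕ F)) :
    v.glue π G (Sum.map id (Sum.map id f) x) = Sum.map id (Sum.map id f) (v.glue π F x) := by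
  rcases x with x | x | x
  · simp only [Vertex.glue, Equiv.trans_apply, Sum.map_inl, Equiv.sumAssoc_symm_apply_inl,
      Equiv.sumCongr_apply, id]
    rcases v.split π (Sum.inl x) with y | y <;> simp
  · simp only [Vertex.glue, Equiv.trans_apply, Sum.map_inl, Sum.map_inr,
      Equiv.sumAssoc_symm_apply_inr_inl, Equiv.sumCongr_apply, id]
    rcases v.split π (Sum.inr x) with y | y <;> simp
  · simp [Vertex.glue]

theorem plug_old {D : PreGraph X} (v : D.Vertex) (π : Fin 3 ≃ v.carrier) (P : PreGraph (Fin 3))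
    (w : {x : X ⊕ D.F // x ∉ v.carrier} ⊕ (Fin 3 ⊕ P.F)) :
    (Sum.map id (Equiv.sumAssoc D.F P.F Bool).symm
      (v.glue π (P.F ⊕ Bool) (Sum.map id (Sum.map id Sum.inl) w)) :
        X ⊕ (plug v π P).addCircle.F) = (plug v π P).old (v.glue π P.F w) := by
  rw [glue_map]
  rcases v.glue π P.F w with z | z | z <;> rfl

/-- Insertion at a vertex is compatible with all changes of the vertices. -/
noncomputable def plugLocal {D : PreGraph X} (v : D.Vertex) (π : Fin 3 ≃ v.carrier) :
    Local (plug v π) where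
  k P f := Sum.inr f
  j P x := v.glue π P.F (Sum.inr x)
  lift P := ((v.glue π P.F).permCongrHom.toMonoidHom).comp
    ((Equiv.Perm.sumCongrHom _ _).comp (MonoidHom.inr _ _))
  j_inr P f := by simp [Vertex.glue, plug]
  j_inj P := (v.glue π P.F).injective.comp Sum.inr_injective
  e_k P f := rfl
  σ_j P x := plug_σ v π P (Sum.inr x)
  lift_exchange P a b := by
    refine (congrArg (v.glue π P.F).permCongr (sumCongr_exchange a b)).trans ?_
    exact permCongr_exchange _ _ _
  rearrange P τ := plug_rearrange v π P τ
  iso P Q := by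
    rintro ⟨f, he, hσ⟩
    refine ⟨Equiv.sumCongr (Equiv.refl _) f, ?_, fun x => ?_⟩
    · rintro (x | x)
      · rfl
      · exact congrArg Sum.inr (he x)
    · obtain ⟨y, rfl⟩ := (v.glue π P.F).surjective x
      have h : ∀ z, Sum.map id (Equiv.sumCongr (Equiv.refl D.F) f) (v.glue π P.F z) =
          v.glue π Q.F (Sum.map id (Sum.map id f) z) := fun z => (glue_map v π f z).symm
      refine (congrArg _ (plug_σ v π P y)).trans ((h _).trans ?_)
      refine Eq.trans ?_ (congrArg _ (h y).symm)
      rw [plug_σ]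
      congr 1
      rcases y with y | y
      · rfl
      · exact congrArg Sum.inr (hσ y)
  c P := (Equiv.sumAssoc D.F P.F Bool).symm
  c_e P x := by rcases x with x | x | x <;> rfl
  c_σ P x := by
    obtain ⟨y, rfl⟩ := (v.glue π P.addCircle.F).surjective x
    refine (congrArg _ (plug_σ v π P.addCircle y)).trans ?_
    obtain ⟨w, rfl⟩ | ⟨b, rfl⟩ : (∃ w, y = Sum.map id (Sum.map id Sum.inl) w) ∨
        ∃ b : Bool, y = Sum.inr (Sum.inr (Sum.inr b)) := by
      rcases y with y | y | y | y
      · exact Or.inl ⟨Sum.inl y, rfl⟩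
      · exact Or.inl ⟨Sum.inr (Sum.inl y), rfl⟩
      · exact Or.inl ⟨Sum.inr (Sum.inr y), rfl⟩
      · exact Or.inr ⟨y, rfl⟩
    · have h : Sum.map v.rest P.addCircle.σ (Sum.map id (Sum.map id Sum.inl) w) =
          Sum.map id (Sum.map id Sum.inl) (Sum.map v.rest P.σ w) := by
        rcases w with w | w
        · rfl
        · exact congrArg Sum.inr (addCircle_σ_old P w)
      refine (congrArg (fun z => Sum.map id (Equiv.sumAssoc D.F P.F Bool).symm
        (v.glue π P.addCircle.F z)) h).trans ?_
      refine (plug_old v π P _).trans (Eq.trans ?_ (congrArg _ (plug_old v π P w).symm))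
      exact (congrArg (plug v π P).old (plug_σ v π P w).symm).trans (addCircle_σ_old _ _).symm
    · rfl
  c_old P a := plug_old v π P (Sum.inr a)
  c_new P b := rfl

end PreGraph

section Modules

open PreGraph

variable (X Y : Type*)

/-- One step of isomorphism or of erasing a bivalent vertex. -/
inductive Step (X : Type*) : PreGraph X → PreGraph X → Prop
  | iso (P Q : PreGraph X) (h : P.Iso Q) : Step X P Q
  | erase (P : PreGraph X) (a : X ⊕ P.F) : Step X (P.subdivide a) P

/-- The set of graphs with boundary `X` up to isomorphism.  A pre-graph stands for the graph to
which it reduces, so these are the pre-graphs up to isomorphism and erasing bivalent vertices. -/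
def GraphClass (X : Type*) := Quot (Step X)

variable {X Y}

/-- The class of a pre-graph. -/
def PreGraph.cls (P : PreGraph X) : GraphClass X := Quot.mk _ P

theorem cls_eq_of_iso {P Q : PreGraph X} (h : P.Iso Q) : P.cls = Q.cls :=
  Quot.sound (Step.iso P Q h)

/-- The map on classes induced by a local construction. -/
def PreGraph.Local.map {Φ : PreGraph Y → PreGraph X} (L : Local Φ) : GraphClass Y → GraphClass X :=
  Quot.lift (fun P => (Φ P).cls) (by
    intro P Q hs
    cases hs with
    | iso _ _ h => exact cls_eq_of_iso (L.iso P Q h)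
    | erase _ a => exact (cls_eq_of_iso (L.subdivide Q a)).trans (Quot.sound (Step.erase _ _)))

variable (R : Type*) [CommRing R]

/-- A pre-graph as a basis element of the free module `R[δ].GraphClass X`. -/
noncomputable def basis (P : PreGraph X) : GraphClass X →₀ Polynomial R :=
  Finsupp.single P.cls 1

/-- The antisymmetry relation, the Jacobi relation and the relation that a circle is `δ`
(the variable of `Polynomial R`). -/
inductive IsRelation (X : Type*) : (GraphClass X →₀ Polynomial R) → Prop
  | as (P : PreGraph X) (x : X ⊕ P.F) (hx : P.IsTrivalentAt x) :
      IsRelation X (basis R P + basis R (P.flip x))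
  | ihx (P : PreGraph X) (h : P.F) (hh : P.IsInnerEdge h) :
      IsRelation X (basis R P + basis R (P.rearrange (P.jacobiCycle h)) +
        basis R (P.rearrange (P.jacobiCycle h)⁻¹))
  | circle (P : PreGraph X) :
      IsRelation X (basis R P.addCircle - (Polynomial.X : Polynomial R) • basis R P)

/-- The submodule of relations. -/
noncomputable def relations (X : Type*) : Submodule (Polynomial R) (GraphClass X →₀ Polynomial R) :=
  Submodule.span (Polynomial R) {r | IsRelation R X r}

/-- The `R[δ]`-module of Jacobi diagrams with boundary `X`. -/
abbrev DiagramModule (X : Type*) := (GraphClass X →₀ Polynomial R) ⧸ relations R X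

theorem PreGraph.Local.mapDomain_basis {Φ : PreGraph Y → PreGraph X} (L : Local Φ)
    (P : PreGraph Y) :
    Finsupp.lmapDomain (Polynomial R) (Polynomial R) L.map (basis R P) = basis R (Φ P) := by
  simp only [basis, Finsupp.lmapDomain_apply, Finsupp.mapDomain_single]
  rfl

theorem PreGraph.Local.relations_le {Φ : PreGraph Y → PreGraph X} (L : Local Φ) :
    relations R Y ≤
      (relations R X).comap (Finsupp.lmapDomain (Polynomial R) (Polynomial R) L.map) := by
  rw [relations, Submodule.span_le]
  rintro _ (⟨P, x, hx⟩ | ⟨P, h, hh⟩ | ⟨P⟩)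
  · rw [SetLike.mem_coe, Submodule.mem_comap, map_add, L.mapDomain_basis R, L.mapDomain_basis R,
      L.flip]
    exact Submodule.subset_span (IsRelation.as _ _ (L.trivalent P x hx))
  · rw [SetLike.mem_coe, Submodule.mem_comap, map_add, map_add, L.mapDomain_basis R,
      L.mapDomain_basis R, L.mapDomain_basis R, L.rearrange, L.rearrange, map_inv, L.jacobiCycle]
    exact Submodule.subset_span (IsRelation.ihx _ _ (L.inner P h hh))
  · rw [SetLike.mem_coe, Submodule.mem_comap, map_sub, map_smul, L.mapDomain_basis R,
      L.mapDomain_basis R, show basis R (Φ P.addCircle) = basis R (Φ P).addCircle by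
        rw [basis, basis, cls_eq_of_iso (L.circle P)]]
    exact Submodule.subset_span (IsRelation.circle _)

/-- The linear map on diagrams induced by a local construction. -/
noncomputable def PreGraph.Local.linearMap {Φ : PreGraph Y → PreGraph X} (L : Local Φ) :
    DiagramModule R Y →ₗ[Polynomial R] DiagramModule R X :=
  Submodule.mapQ _ _ (Finsupp.lmapDomain (Polynomial R) (Polynomial R) L.map) (L.relations_le R)

/-- The action of the bijections of the boundary on diagrams. -/
noncomputable def relabelMap (φ : X ≃ Y) : DiagramModule R X →ₗ[Polynomial R] DiagramModule R Y :=
  (relabelLocal φ).linearMap R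

/-- The map `ψ(D, v, π)`, which sends a diagram with three legs to the diagram obtained by
inserting it at the vertex `v` of `D`. -/
noncomputable def psi {D : PreGraph X} (v : D.Vertex) (π : Fin 3 ≃ v.carrier) :
    DiagramModule R (Fin 3) →ₗ[Polynomial R] DiagramModule R X :=
  (plugLocal v π).linearMap R

/-- The submodule `Λ` of totally antisymmetric elements with three legs. -/
noncomputable def Lam : Submodule (Polynomial R) (DiagramModule R (Fin 3)) :=
  ⨅ s : Equiv.Perm (Fin 3),
    LinearMap.ker (relabelMap R s - ((Equiv.Perm.sign s : ℤˣ) : ℤ) • LinearMap.id)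

theorem mem_Lam (T : DiagramModule R (Fin 3)) :
    T ∈ Lam R ↔ ∀ s : Equiv.Perm (Fin 3),
      relabelMap R s T = ((Equiv.Perm.sign s : ℤˣ) : ℤ) • T := by
  simp [Lam, sub_eq_zero]

/-- `ψ(D, v, π)` on the class of a pre-graph is the class of the pre-graph obtained by
insertion. -/
theorem psi_mk {D : PreGraph X} (v : D.Vertex) (π : Fin 3 ≃ v.carrier)
    (T : PreGraph (Fin 3)) :
    psi R v π ((relations R (Fin 3)).mkQ (basis R T)) =
      (relations R X).mkQ (basis R (plug v π T)) := by
  simp only [psi, PreGraph.Local.linearMap, Submodule.mkQ_apply, Submodule.mapQ_apply]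
  rw [(plugLocal v π).mapDomain_basis R]

end Modules

end Jacobi

/-!
Renumbering the half-edges at a vertex multiplies the result of inserting a totally antisymmetric
diagram `T` there by the sign of the renumbering, and two cyclic numberings differ by a rotation,
which is even (`psi_eq_of_isCyclic`). The essential point is that
insertion at two adjacent vertices `u`, `v` gives the same result.

The main tool is the following consequence of the AS and IHX relations
(`sum_diagram_attach_eq_zero`): if `T` lies inside a larger diagram, then the sum over the legs of
`T` of the diagrams obtained by attaching an extra leg to this leg of `T` is zero. Attaching the
extra leg next to each half-edge of `T` gives a sum which vanishes at each vertex of `T` (by IHX at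
a trivalent vertex, by AS at a bivalent one), while the two ends of an inner edge of `T` cancel by
AS; what is left is the sum over the legs. The extra leg is provided by a vertex `(f, d, e f)` with a
loop: exchanging `f` and `y` cuts the loop and inserts it, with the leg `d`, into the edge of `y`.

Let the edge joining `u` and `v` together with the other half-edges `a, b` at `u` and `c, d` at `v`
form a tree with four legs. Write `A, B, C` for the diagrams in which these legs are paired as
`ab|cd`, `bc|ad`, `ca|bd` and `T` is inserted at the vertex of the first pair, and `A', B', C'` for
those with `T` at the vertex of the second pair. With each of the four legs as the extra leg in
turn, the vanishing of the sum above gives `A + B + C = 0`, `A + B' + C' = 0`, `A' + B' + C = 0` and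
`A' + B + C' = 0`. The first two minus the last two give `2A = 2A'`, and `2` is invertible
(`two_nsmul_eq_of_four_leg_relations`, `psi_eq_of_adjacent_of_ne`).

In a graph, a bivalent vertex belongs to an interval or a circle component, so a path between
trivalent vertices passes only through trivalent vertices, and the case of a connected component
follows by induction along the path (`psi_eq_of_connected`).

All diagrams which occur arise from a fixed pre-graph by permuting a few half-edges among
themselves. Such permutations are written as extensions, along an embedding `θ` of `Fin n` into the
half-edges, of explicit permutations of `Fin n`, so that coincidences of diagrams reduce to
identities in a symmetric group (`viaEmbedding_conj`).
-/

namespace Jacobi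

/-! ### Permutations supported on finitely many half-edges -/

section Frames

open Equiv

variable {ι α β : Type*}

theorem exchange_eq_viaEmbedding [DecidableEq ι] (θ : ι ↪ α) (i j : ι) :
    exchange (θ i) (θ j) = (swap i j).viaEmbedding θ := by
  classical
  rw [exchange_eq_swap]
  ext x
  by_cases hx : x ∈ Set.range θ
  · obtain ⟨k, rfl⟩ := hx
    rw [Perm.viaEmbedding_apply, θ.injective.swap_apply]
  · rw [Perm.viaEmbedding_apply_of_notMem _ _ _ hx]
    exact swap_apply_of_ne_of_ne (fun h => hx ⟨i, h.symm⟩) (fun h => hx ⟨j, h.symm⟩)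

theorem exchange_mul (τ : Perm α) (a b : α) :
    exchange (τ a) (τ b) * τ = τ * exchange a b := by
  ext x
  exact (map_exchange τ.injective a b x).symm

theorem eq_conj_of_apply {σ τ ρ : Perm α} (h : ∀ x, ρ (τ x) = τ (σ x)) : ρ = τ * σ * τ⁻¹ := by
  rw [eq_mul_inv_iff_mul_eq]
  exact Equiv.ext h

theorem conj_eq_mul_conj {σ τ ρ : Perm α} (π : Perm α) (h : ρ = τ * σ * τ⁻¹) :
    π * ρ * π⁻¹ = π * τ * σ * (π * τ)⁻¹ := by
  rw [h]
  group

theorem viaEmbedding_mul (θ : ι ↪ α) (s t : Perm ι) :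
    (s * t).viaEmbedding θ = s.viaEmbedding θ * t.viaEmbedding θ := by
  simp only [← Perm.viaEmbeddingHom_apply, map_mul]

theorem viaEmbedding_inv (θ : ι ↪ α) (s : Perm ι) :
    s⁻¹.viaEmbedding θ = (s.viaEmbedding θ)⁻¹ := by
  simp only [← Perm.viaEmbeddingHom_apply, map_inv]

theorem viaEmbedding_one (θ : ι ↪ α) : (1 : Perm ι).viaEmbedding θ = 1 := by
  simp only [← Perm.viaEmbeddingHom_apply, map_one]

theorem exchange_viaEmbedding (η : α ↪ β) (a b : α) :
    (exchange a b).viaEmbedding η = exchange (η a) (η b) := by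
  classical
  rw [exchange_eq_swap, exchange_eq_viaEmbedding]

/-- If `σ` restricts to `s` on the points moved by `c`, and `c` commutes with `s`, then the
extension of `c` by the identity commutes with `σ`. -/
theorem viaEmbedding_mul_comm (θ : ι ↪ α) (σ : Perm α) (s c : Perm ι)
    (hσ : ∀ i, c i = i ∨ σ (θ i) = θ (s i)) (hc : c * s = s * c) :
    c.viaEmbedding θ * σ = σ * c.viaEmbedding θ := by
  have hcs : ∀ i, c (s i) = s (c i) := fun i => DFunLike.congr_fun hc i
  have hinv : ∀ k, s (s⁻¹ k) = k := fun k => s.apply_symm_apply k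
  have hfix : ∀ x, c.viaEmbedding θ x = x → c.viaEmbedding θ (σ x) = σ x := by
    intro x hx
    by_contra hne
    have hr : σ x ∈ Set.range θ := by
      by_contra h
      exact hne (Perm.viaEmbedding_apply_of_notMem _ _ _ h)
    obtain ⟨k, hk⟩ := hr
    rw [← hk, Perm.viaEmbedding_apply] at hne
    have hk' : c (s⁻¹ k) ≠ s⁻¹ k := by
      intro h
      have h' := hcs (s⁻¹ k)
      rw [hinv, h, hinv] at h'
      exact hne (congrArg θ h')
    have hxk : x = θ (s⁻¹ k) := by
      apply σ.injective
      rw [(hσ _).resolve_left hk', hinv, hk]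
    rw [hxk, Perm.viaEmbedding_apply] at hx
    exact hk' (θ.injective hx)
  ext x
  simp only [Perm.mul_apply]
  by_cases hx : c.viaEmbedding θ x = x
  · rw [hfix x hx, hx]
  · have hr : x ∈ Set.range θ := by
      by_contra h
      exact hx (Perm.viaEmbedding_apply_of_notMem _ _ _ h)
    obtain ⟨i, rfl⟩ := hr
    have hi : c i ≠ i := fun h => hx (by rw [Perm.viaEmbedding_apply, h])
    have hi' : c (c i) ≠ c i := fun h => hi (c.injective h)
    rw [(hσ i).resolve_left hi, Perm.viaEmbedding_apply, Perm.viaEmbedding_apply,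
      (hσ _).resolve_left hi', hcs]

/-- Two permutations of the frame `θ` conjugate `σ` to the same permutation if they differ by
a permutation which commutes with the restriction `s` of `σ`. -/
theorem viaEmbedding_conj (θ : ι ↪ α) (σ : Perm α) (s a b : Perm ι)
    (hσ : ∀ i, (b⁻¹ * a) i = i ∨ σ (θ i) = θ (s i)) (hc : b⁻¹ * a * s = s * (b⁻¹ * a)) :
    a.viaEmbedding θ * σ * (a.viaEmbedding θ)⁻¹ = b.viaEmbedding θ * σ * (b.viaEmbedding θ)⁻¹ := by
  have h := viaEmbedding_mul_comm θ σ s (b⁻¹ * a) hσ hc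
  rw [viaEmbedding_mul, viaEmbedding_inv] at h
  rw [mul_inv_eq_iff_eq_mul, mul_assoc _ _ (a.viaEmbedding θ), mul_assoc,
    ← inv_mul_eq_iff_eq_mul, ← mul_assoc, h]

/-- A function on the points of a permutation with orbits of order two and three has sum zero if
its sum over each orbit is zero. -/
theorem HasSmallOrbits.sum_eq_zero {M : Type*} [AddCommMonoid M] [Fintype α] {σ : Perm α}
    (hσ : HasSmallOrbits σ) (g : α → M) (g2 : ∀ x, σ (σ x) = x → g x + g (σ x) = 0)
    (g3 : ∀ x, σ (σ x) ≠ x → g x + g (σ x) + g (σ (σ x)) = 0) : ∑ x, g x = 0 := by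
  classical
  suffices h : ∀ n (S : Finset α), S.card = n → (∀ x ∈ S, σ x ∈ S) → ∑ x ∈ S, g x = 0 from
    h _ Finset.univ rfl (by simp)
  intro n
  induction n using Nat.strong_induction_on with
  | _ n ih =>
    intro S hn hS
    rcases S.eq_empty_or_nonempty with rfl | ⟨x, hx⟩
    · simp
    -- remove the orbit of one point
    obtain ⟨O, hO, hOx, hO0, hOσ⟩ : ∃ O ⊆ S, x ∈ O ∧ ∑ y ∈ O, g y = 0 ∧
        ∀ y, σ y ∈ O → y ∈ O := by
      by_cases h : σ (σ x) = x
      · refine ⟨{x, σ x}, ?_, by simp, ?_, ?_⟩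
        · simp [Finset.insert_subset_iff, hx, hS]
        · rw [Finset.sum_pair (hσ x).1.symm, g2 x h]
        · intro y
          simp only [Finset.mem_insert, Finset.mem_singleton, EmbeddingLike.apply_eq_iff_eq]
          rintro (hy | hy)
          · exact Or.inr (σ.injective (hy.trans h.symm))
          · exact Or.inl hy
      · have h3 := (hσ x).2.resolve_left h
        refine ⟨{x, σ x, σ (σ x)}, ?_, by simp, ?_, ?_⟩
        · simp [Finset.insert_subset_iff, hx, hS]
        · rw [Finset.sum_insert, Finset.sum_pair (hσ (σ x)).1.symm, ← add_assoc, g3 x h]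
          simp [(hσ x).1.symm, Ne.symm h]
        · intro y
          simp only [Finset.mem_insert, Finset.mem_singleton, EmbeddingLike.apply_eq_iff_eq]
          rintro (hy | hy | hy)
          · exact Or.inr (Or.inr (σ.injective (hy.trans h3.symm)))
          · exact Or.inl hy
          · exact Or.inr (Or.inl hy)
    have hcard : (S \ O).card < n := by
      rw [← hn]
      exact Finset.card_lt_card (Finset.sdiff_ssubset hO ⟨x, hOx⟩)
    rw [← Finset.sum_sdiff hO, hO0, add_zero]
    refine ih _ hcard _ rfl fun y hy => ?_
    rw [Finset.mem_sdiff] at hy ⊢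
    exact ⟨hS y hy.1, fun h => hy.2 (hOσ y h)⟩

end Frames

/-! ### Relations between classes of pre-graphs -/

section Classes

open PreGraph

variable {X Y : Type*}

namespace PreGraph

theorem rearrange_σ (P : PreGraph X) (τ : Equiv.Perm (X ⊕ P.F)) (x : X ⊕ P.F) :
    (P.rearrange τ).σ (τ x) = τ (P.σ x) := by
  change (τ * P.σ * τ⁻¹) (τ x) = _
  simp

theorem rearrange_rearrange (P : PreGraph X) (τ τ' : Equiv.Perm (X ⊕ P.F)) :
    (P.rearrange τ).rearrange τ' = P.rearrange (τ' * τ) := by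
  have key : τ' * (τ * P.σ * τ⁻¹) * τ'⁻¹ = τ' * τ * P.σ * (τ' * τ)⁻¹ := by group
  exact mk_congr key

theorem rearrange_congr (P : PreGraph X) {τ τ' : Equiv.Perm (X ⊕ P.F)}
    (h : τ * P.σ * τ⁻¹ = τ' * P.σ * τ'⁻¹) : P.rearrange τ = P.rearrange τ' :=
  mk_congr h

theorem rearrange_viaEmbedding {ι : Type*} (P : PreGraph X) (θ : ι ↪ X ⊕ P.F)
    (s t : Equiv.Perm ι) :
    (P.rearrange (s.viaEmbedding θ)).rearrange (t.viaEmbedding θ) =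
      P.rearrange ((t * s).viaEmbedding θ) := by
  rw [viaEmbedding_mul]
  exact P.rearrange_rearrange _ _

theorem flip_rearrange (P : PreGraph X) (τ : Equiv.Perm (X ⊕ P.F)) (x : X ⊕ P.F) :
    (P.rearrange τ).flip (τ x) = P.rearrange (τ * exchange x (P.σ x)) := by
  unfold flip
  rw [rearrange_σ]
  refine (P.rearrange_rearrange τ _).trans ?_
  exact congrArg P.rearrange (exchange_mul τ x (P.σ x))

theorem isTrivalentAt_rearrange (P : PreGraph X) (τ : Equiv.Perm (X ⊕ P.F)) {x : X ⊕ P.F}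
    (h : P.IsTrivalentAt x) : (P.rearrange τ).IsTrivalentAt (τ x) := by
  unfold IsTrivalentAt
  rw [rearrange_σ, rearrange_σ]
  exact fun h' => h (τ.injective h')

/-- Renaming the half-edges by a permutation which respects the edges. -/
theorem iso_rearrange (P : PreGraph X) (φ : Equiv.Perm P.F) (hφ : φ * P.e = P.e * φ) :
    P.Iso (P.rearrange (Equiv.Perm.sumCongr 1 φ)) := by
  refine ⟨φ, fun x => DFunLike.congr_fun hφ x, fun x => ?_⟩
  have h : ∀ z : X ⊕ P.F, Sum.map id φ z = Equiv.Perm.sumCongr (1 : Equiv.Perm X) φ z := by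
    rintro (z | z) <;> rfl
  exact (h _).trans ((P.rearrange_σ _ x).symm.trans (congrArg _ (h x).symm))

theorem old_injective (P : PreGraph X) : Function.Injective P.old :=
  Function.Injective.sumMap Function.injective_id Sum.inl_injective

theorem old_ne_new (P : PreGraph X) (a : X ⊕ P.F) (b : Bool) : P.old a ≠ P.new b := by
  rintro h
  rcases a with a | a
  · exact Sum.inl_ne_inr h
  · exact Sum.inl_ne_inr (Sum.inr_injective h)

theorem iso_sumCongr_mul (P : PreGraph X) (τ : Equiv.Perm (X ⊕ P.F)) (φ : Equiv.Perm P.F)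
    (hφ : φ * P.e = P.e * φ) :
    (P.rearrange τ).Iso (P.rearrange (Equiv.Perm.sumCongr 1 φ * τ)) := by
  rw [← rearrange_rearrange]
  exact iso_rearrange (P.rearrange τ) φ hφ

/-- The half-edges of `P` inside those of `P.addCircle`. -/
def oldEmbedding (P : PreGraph X) : X ⊕ P.F ↪ X ⊕ P.addCircle.F := ⟨P.old, P.old_injective⟩

theorem addCircle_rearrange_σ (P : PreGraph X) (τ : Equiv.Perm (X ⊕ P.F)) :
    (P.rearrange τ).addCircle.σ =
      τ.viaEmbedding P.oldEmbedding * P.addCircle.σ * (τ.viaEmbedding P.oldEmbedding)⁻¹ := by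
  have hnew : ∀ c, τ.viaEmbedding P.oldEmbedding (P.new c) = P.new c := fun c =>
    Equiv.Perm.viaEmbedding_apply_of_notMem _ _ _ (by rintro ⟨a, ha⟩; exact P.old_ne_new a c ha)
  have hold : ∀ c, τ.viaEmbedding P.oldEmbedding (P.old c) = P.old (τ c) := fun c =>
    Equiv.Perm.viaEmbedding_apply τ P.oldEmbedding c
  refine eq_conj_of_apply fun x => ?_
  rcases P.old_or_new x with ⟨c, rfl⟩ | ⟨c, rfl⟩
  · refine (congrArg _ (hold c)).trans ?_
    refine ((P.rearrange τ).addCircle_σ_old (τ c)).trans ?_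
    refine (congrArg (P.rearrange τ).old (rearrange_σ P _ c)).trans ?_
    exact (hold (P.σ c)).symm.trans (congrArg _ (P.addCircle_σ_old c).symm)
  · refine (congrArg _ (hnew c)).trans ?_
    exact (hnew (!c)).symm.trans (congrArg _ (P.addCircle_σ_new c).symm)

theorem subdivide_rearrange (P : PreGraph X) (τ : Equiv.Perm (X ⊕ P.F)) (a : X ⊕ P.F) :
    (P.rearrange τ).subdivide a = P.addCircle.rearrange
      (exchange (P.old a) (P.new false) * τ.viaEmbedding P.oldEmbedding) := by
  exact mk_congr (conj_eq_mul_conj _ (P.addCircle_rearrange_σ τ))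

end PreGraph

variable (R : Type*) [CommRing R]

/-- The diagram represented by a pre-graph. -/
noncomputable def diagram (P : PreGraph X) : DiagramModule R X :=
  (relations R X).mkQ (basis R P)

theorem diagram_eq_of_iso {P Q : PreGraph X} (h : P.Iso Q) : diagram R P = diagram R Q := by
  rw [diagram, diagram, basis, basis, cls_eq_of_iso h]

theorem diagram_subdivide (P : PreGraph X) (a : X ⊕ P.F) :
    diagram R (P.subdivide a) = diagram R P := by
  have h : (P.subdivide a).cls = P.cls := Quot.sound (Step.erase P a)
  rw [diagram, diagram, basis, basis, h]

theorem diagram_flip (P : PreGraph X) (x : X ⊕ P.F) (hx : P.IsTrivalentAt x) :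
    diagram R (P.flip x) = - diagram R P := by
  rw [eq_neg_iff_add_eq_zero, add_comm, diagram, diagram, ← map_add]
  exact (Submodule.Quotient.mk_eq_zero _).2 (Submodule.subset_span (IsRelation.as P x hx))

theorem diagram_rearrange_mul_exchange (P : PreGraph X) (τ : Equiv.Perm (X ⊕ P.F)) (x : X ⊕ P.F)
    (hx : P.IsTrivalentAt x) :
    diagram R (P.rearrange (τ * exchange x (P.σ x))) = - diagram R (P.rearrange τ) := by
  rw [← flip_rearrange]
  exact diagram_flip R _ _ (P.isTrivalentAt_rearrange τ hx)

theorem diagram_jacobi (P : PreGraph X) (h : P.F) (hh : P.IsInnerEdge h) :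
    diagram R P + diagram R (P.rearrange (P.jacobiCycle h)) +
      diagram R (P.rearrange (P.jacobiCycle h)⁻¹) = 0 := by
  rw [diagram, diagram, diagram, ← map_add, ← map_add]
  exact (Submodule.Quotient.mk_eq_zero _).2 (Submodule.subset_span (IsRelation.ihx P h hh))

/-- Diagrams represented by pre-graphs span, so a linear map is determined by its values on
them. -/
theorem linearMap_ext_diagram {M : Type*} [AddCommGroup M] [Module (Polynomial R) M]
    {f g : DiagramModule R X →ₗ[Polynomial R] M} (h : ∀ P, f (diagram R P) = g (diagram R P)) :
    f = g := by
  refine Submodule.linearMap_qext _ (Finsupp.lhom_ext' fun c => LinearMap.ext_ring ?_)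
  obtain ⟨P, rfl⟩ := Quot.exists_rep c
  exact h P

theorem relabelMap_diagram (φ : X ≃ Y) (P : PreGraph X) :
    relabelMap R φ (diagram R P) = diagram R (P.relabel φ) := by
  simp only [relabelMap, PreGraph.Local.linearMap, diagram, Submodule.mkQ_apply,
    Submodule.mapQ_apply]
  rw [(relabelLocal φ).mapDomain_basis R]

end Classes

/-! ### Attaching a leg at a half-edge -/

section Attach

open PreGraph Equiv

variable {X Y : Type*}

namespace PreGraph

/-- The edge of `f` is a loop at a trivalent vertex `(f, d, e f)`.  The third half-edge `d` of this
vertex plays the role of a free leg, which `attach` connects to other edges. -/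
def IsTadpole (P : PreGraph X) (f : P.F) : Prop :=
  P.σ (P.σ (Sum.inr f)) = Sum.inr (P.e f)

/-- The half-edge `y` is not at the vertex of the half-edge `f` of a tadpole. -/
structure OffTadpole (P : PreGraph X) (f : P.F) (y : X ⊕ P.F) : Prop where
  ne_fst : y ≠ Sum.inr f
  ne_snd : y ≠ P.σ (Sum.inr f)
  ne_trd : y ≠ Sum.inr (P.e f)

/-- Cut the loop of a tadpole `(f, d, e f)` and insert it into the edge of `y`: the half-edge `f`
takes the place of `y`, and `(y, d, e f)` is the vertex by which `d` is attached to the edge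
of `y`. -/
noncomputable def attach (P : PreGraph X) (f : P.F) (y : X ⊕ P.F) : PreGraph X :=
  P.rearrange (exchange (Sum.inr f) y)

variable {P : PreGraph X} {f : P.F}

namespace IsTadpole

theorem σ_e (h : P.IsTadpole f) : P.σ (Sum.inr (P.e f)) = Sum.inr f := by
  have h1 : P.σ (P.σ (Sum.inr f)) ≠ Sum.inr f := by
    rw [h]
    exact fun h' => P.e_ne f (Sum.inr_injective h')
  rw [← h]
  exact (P.orbits _).2.resolve_left h1

theorem σ_ne (h : P.IsTadpole f) : P.σ (Sum.inr f) ≠ Sum.inr (P.e f) :=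
  fun h' => (P.orbits (P.σ (Sum.inr f))).1 (h.trans h'.symm)

theorem off_σ (h : P.IsTadpole f) {y : X ⊕ P.F} (hy : P.OffTadpole f y) :
    P.OffTadpole f (P.σ y) where
  ne_fst h' := hy.ne_trd (P.σ.injective (h'.trans h.σ_e.symm))
  ne_snd h' := hy.ne_fst (P.σ.injective h')
  ne_trd h' := hy.ne_snd (P.σ.injective (h'.trans (Eq.symm h)))

theorem isTrivalentAt_snd (h : P.IsTadpole f) : P.IsTrivalentAt (P.σ (Sum.inr f)) := by
  unfold IsTrivalentAt
  rw [show P.σ (P.σ (Sum.inr f)) = Sum.inr (P.e f) from h, h.σ_e]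
  exact (P.orbits _).1.symm

end IsTadpole

end PreGraph

variable (R : Type*) [CommRing R] {P : PreGraph X} {f : P.F}

/-- At a trivalent vertex `(y, y', y'')`, the three ways of attaching the free leg `d` are the three
terms of a Jacobi relation for the edge of `f`. -/
theorem diagram_attach_trivalent (h : P.IsTadpole f) {y : X ⊕ P.F} (hy : P.OffTadpole f y)
    (hy3 : P.σ (P.σ y) ≠ y) :
    diagram R (P.attach f y) + diagram R (P.attach f (P.σ y)) +
      diagram R (P.attach f (P.σ (P.σ y))) = 0 := by
  have hy' := h.off_σ hy
  have hy'' := h.off_σ hy'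
  have h3 := (P.orbits y).2.resolve_left hy3
  let θ : Fin 6 ↪ X ⊕ P.F := ⟨![Sum.inr f, P.σ (Sum.inr f), Sum.inr (P.e f), y, P.σ y, P.σ (P.σ y)],
    List.nodup_ofFn.mp (by
      simp [hy.ne_fst.symm, hy.ne_snd.symm, hy.ne_trd.symm, hy'.ne_fst.symm, hy'.ne_snd.symm,
        hy'.ne_trd.symm, hy''.ne_fst.symm, hy''.ne_snd.symm, hy''.ne_trd.symm, h.σ_ne,
        (P.orbits (Sum.inr f)).1.symm, (P.e_ne f).symm, (P.orbits y).1.symm, hy3.symm,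
        (P.orbits (P.σ y)).1.symm])⟩
  have hθ : ∀ i, P.σ (θ i) = θ ((swap 0 1 * swap 1 2 * (swap 3 4 * swap 4 5) : Perm (Fin 6)) i) := by
    intro i
    fin_cases i
    exacts [rfl, h, h.σ_e, rfl, rfl, h3]
  have hσ : ∀ τ : Perm (Fin 6), ∀ i, (P.rearrange (τ.viaEmbedding θ)).σ (θ (τ i)) =
      θ (τ ((swap 0 1 * swap 1 2 * (swap 3 4 * swap 4 5) : Perm (Fin 6)) i)) := by
    intro τ i
    rw [← Perm.viaEmbedding_apply, rearrange_σ, hθ, Perm.viaEmbedding_apply]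
  have e0 : P.attach f y = P.rearrange ((swap 0 3 : Perm (Fin 6)).viaEmbedding θ) :=
    congrArg P.rearrange (exchange_eq_viaEmbedding θ 0 3)
  have e1 : P.attach f (P.σ y) = P.rearrange ((swap 0 4 : Perm (Fin 6)).viaEmbedding θ) :=
    congrArg P.rearrange (exchange_eq_viaEmbedding θ 0 4)
  have e2 : P.attach f (P.σ (P.σ y)) = P.rearrange ((swap 0 5 : Perm (Fin 6)).viaEmbedding θ) :=
    congrArg P.rearrange (exchange_eq_viaEmbedding θ 0 5)
  set Q := P.rearrange ((swap 0 3 : Perm (Fin 6)).viaEmbedding θ)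
  -- the vertices of `Q` are `(f, σ y, σ² y)` and `(e f, y, d)`
  have q0 : Q.σ (θ 0) = θ 4 := hσ (swap 0 3) 3
  have q4 : Q.σ (θ 4) = θ 5 := hσ (swap 0 3) 4
  have q2 : Q.σ (θ 2) = θ 3 := hσ (swap 0 3) 2
  have q3 : Q.σ (θ 3) = θ 1 := hσ (swap 0 3) 0
  have hin : Q.IsInnerEdge f := by
    refine ⟨?_, ?_, ?_, ?_⟩
    · change Q.σ (Q.σ (θ 0)) ≠ θ 0
      rw [q0, q4]
      exact θ.injective.ne (by decide)
    · change Q.σ (Q.σ (θ 2)) ≠ θ 2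
      rw [q2, q3]
      exact θ.injective.ne (by decide)
    · change Q.σ (θ 0) ≠ θ 2
      rw [q0]
      exact θ.injective.ne (by decide)
    · change Q.σ (Q.σ (θ 0)) ≠ θ 2
      rw [q0, q4]
      exact θ.injective.ne (by decide)
  have hJ : Q.jacobiCycle f = (swap 4 5 * swap 5 3 : Perm (Fin 6)).viaEmbedding θ := by
    have hJ' : Q.jacobiCycle f = exchange (Q.σ (θ 0)) (Q.σ (Q.σ (θ 0))) *
      exchange (Q.σ (Q.σ (θ 0))) (Q.σ (θ 2)) := rfl
    rw [hJ', q0, q4, q2, viaEmbedding_mul]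
    exact congrArg₂ (· * ·) (exchange_eq_viaEmbedding θ 4 5) (exchange_eq_viaEmbedding θ 5 3)
  have hd := diagram_jacobi R Q f hin
  have hJ' : (Q.jacobiCycle f)⁻¹ = (swap 4 5 * swap 5 3 : Perm (Fin 6))⁻¹.viaEmbedding θ := by
    rw [hJ]
    exact (viaEmbedding_inv θ _).symm
  -- the two sides agree up to rotating the vertex `(y, σ y, σ² y)`, which does not change `P`
  have r1 : Q.rearrange (Q.jacobiCycle f) =
      P.rearrange ((swap 0 4 : Perm (Fin 6)).viaEmbedding θ) := by
    rw [hJ]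
    exact (P.rearrange_viaEmbedding θ _ _).trans
      (P.rearrange_congr (viaEmbedding_conj θ P.σ _ _ _ (fun i => Or.inr (hθ i)) (by decide)))
  have r2 : Q.rearrange (Q.jacobiCycle f)⁻¹ =
      P.rearrange ((swap 0 5 : Perm (Fin 6)).viaEmbedding θ) := by
    rw [hJ']
    exact (P.rearrange_viaEmbedding θ _ _).trans
      (P.rearrange_congr (viaEmbedding_conj θ P.σ _ _ _ (fun i => Or.inr (hθ i)) (by decide)))
  rw [e0, e1, e2, ← r1, ← r2]
  exact hd

/-- Attaching the free leg from the two ends of the same edge gives opposite results, by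
antisymmetry at the new vertex. -/
theorem diagram_attach_e (h : P.IsTadpole f) {g : P.F} (hg : P.OffTadpole f (Sum.inr g))
    (hg' : P.OffTadpole f (Sum.inr (P.e g))) :
    diagram R (P.attach f (Sum.inr g)) + diagram R (P.attach f (Sum.inr (P.e g))) = 0 := by
  let θ : Fin 5 ↪ X ⊕ P.F :=
    ⟨![Sum.inr f, P.σ (Sum.inr f), Sum.inr (P.e f), Sum.inr g, Sum.inr (P.e g)],
      List.nodup_ofFn.mp (by
        have := hg.ne_fst.symm
        have := hg.ne_trd.symm
        have := hg'.ne_fst.symm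
        have := hg'.ne_trd.symm
        simp_all [hg.ne_snd.symm, hg'.ne_snd.symm, h.σ_ne,
          (P.orbits (Sum.inr f)).1.symm, (P.e_ne f).symm, (P.e_ne g).symm])⟩
  have hθ : ∀ i, (i = 3 ∨ i = 4) ∨
      P.σ (θ i) = θ ((swap 0 1 * swap 1 2 : Perm (Fin 5)) i) := by
    intro i
    fin_cases i
    exacts [Or.inr rfl, Or.inr h, Or.inr h.σ_e, Or.inl (by decide), Or.inl (by decide)]
  -- the two pre-graphs differ by the renaming `f ↦ g ↦ e f ↦ e g ↦ f` and a reversed vertex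
  let η : Fin 4 ↪ P.F := ⟨![f, g, P.e f, P.e g],
    List.nodup_ofFn.mp (by
      have h1 : f ≠ g := fun h' => hg.ne_fst (congrArg Sum.inr h'.symm)
      have h2 : f ≠ P.e g := fun h' => hg'.ne_fst (congrArg Sum.inr h'.symm)
      have h3 : g ≠ P.e f := fun h' => hg.ne_trd (congrArg Sum.inr h')
      simp [h1, h2, h3, (P.e_ne f).symm, (P.e_ne g).symm])⟩
  let φ : Perm P.F := exchange f g * exchange g (P.e f) * exchange (P.e f) (P.e g)
  have hφη : φ = (swap 0 1 * swap 1 2 * swap 2 3 : Perm (Fin 4)).viaEmbedding η := by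
    rw [viaEmbedding_mul, viaEmbedding_mul]
    exact congrArg₂ (· * ·) (congrArg₂ (· * ·) (exchange_eq_viaEmbedding η 0 1)
      (exchange_eq_viaEmbedding η 1 2)) (exchange_eq_viaEmbedding η 2 3)
  have hφe : φ * P.e = P.e * φ := by
    rw [hφη]
    refine viaEmbedding_mul_comm η P.e (swap 0 2 * swap 1 3) _ (fun i => Or.inr ?_) (by decide)
    fin_cases i
    exacts [rfl, rfl, P.e_e f, P.e_e g]
  have hφθ : Perm.sumCongr (1 : Perm X) φ =
      (swap 0 3 * swap 3 2 * swap 2 4 : Perm (Fin 5)).viaEmbedding θ := by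
    have h1 : Perm.sumCongr (1 : Perm X) φ = Perm.sumCongr 1 (exchange f g) *
        Perm.sumCongr 1 (exchange g (P.e f)) * Perm.sumCongr 1 (exchange (P.e f) (P.e g)) := by
      rw [Perm.sumCongr_mul, Perm.sumCongr_mul]
      rfl
    rw [h1, sumCongr_exchange, sumCongr_exchange, sumCongr_exchange, viaEmbedding_mul,
      viaEmbedding_mul]
    exact congrArg₂ (· * ·) (congrArg₂ (· * ·) (exchange_eq_viaEmbedding θ 0 3)
      (exchange_eq_viaEmbedding θ 3 2)) (exchange_eq_viaEmbedding θ 2 4)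
  have e0 : P.attach f (Sum.inr g) = P.rearrange ((swap 0 3 : Perm (Fin 5)).viaEmbedding θ) :=
    congrArg P.rearrange (exchange_eq_viaEmbedding θ 0 3)
  have e1 : P.attach f (Sum.inr (P.e g)) =
      P.rearrange ((swap 0 4 : Perm (Fin 5)).viaEmbedding θ) :=
    congrArg P.rearrange (exchange_eq_viaEmbedding θ 0 4)
  have hflip : diagram R (P.rearrange ((swap 0 4 * swap 1 2 : Perm (Fin 5)).viaEmbedding θ)) =
      - diagram R (P.rearrange ((swap 0 4 : Perm (Fin 5)).viaEmbedding θ)) := by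
    rw [← diagram_rearrange_mul_exchange R P _ _ h.isTrivalentAt_snd, viaEmbedding_mul,
      ← exchange_eq_viaEmbedding θ 1 2]
    exact congrArg (fun z => diagram R (P.rearrange (_ * exchange (P.σ (Sum.inr f)) z))) h.symm
  have hiso := P.iso_sumCongr_mul ((swap 0 3 : Perm (Fin 5)).viaEmbedding θ) φ hφe
  have he : P.rearrange (Perm.sumCongr (1 : Perm X) φ * (swap 0 3 : Perm (Fin 5)).viaEmbedding θ) =
      P.rearrange ((swap 0 4 * swap 1 2 : Perm (Fin 5)).viaEmbedding θ) := by
    rw [hφθ, ← viaEmbedding_mul]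
    exact P.rearrange_congr (viaEmbedding_conj θ P.σ (swap 0 1 * swap 1 2) _ _
      (fun i => (hθ i).imp_left (by rintro (rfl | rfl) <;> decide)) (by decide))
  rw [e0, e1, diagram_eq_of_iso R hiso, he, hflip, neg_add_cancel]

/-- The two ways of attaching the free leg next to a bivalent vertex give opposite results: up to
erasing the bivalent vertex, they differ by a reversal of the new vertex. -/
theorem diagram_attach_bivalent (h : P.IsTadpole f) {y : X ⊕ P.F} (hy : P.OffTadpole f y)
    (hy2 : P.σ (P.σ y) = y) :
    diagram R (P.attach f y) + diagram R (P.attach f (P.σ y)) = 0 := by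
  have hy' := h.off_σ hy
  let θ : Fin 7 ↪ X ⊕ P.addCircle.F :=
    ⟨![P.old (Sum.inr f), P.old (P.σ (Sum.inr f)), P.old (Sum.inr (P.e f)), P.old y,
        P.old (P.σ y), P.new false, P.new true],
      List.nodup_ofFn.mp (by
        have hn : P.new false ≠ P.new true := fun h' =>
          Bool.false_ne_true (Sum.inr_injective (Sum.inr_injective h'))
        simp [P.old_injective.eq_iff, P.old_ne_new, hn, hy.ne_fst.symm, hy.ne_snd.symm,
          hy.ne_trd.symm, hy'.ne_fst.symm, hy'.ne_snd.symm, hy'.ne_trd.symm, h.σ_ne,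
          (P.orbits (Sum.inr f)).1.symm, (P.e_ne f).symm, (P.orbits y).1.symm])⟩
  have hθ : ∀ i, P.addCircle.σ (θ i) =
      θ ((swap 0 1 * swap 1 2 * (swap 3 4 * swap 5 6) : Perm (Fin 7)) i) := by
    intro i
    fin_cases i
    exacts [P.addCircle_σ_old (Sum.inr f),
      (P.addCircle_σ_old (P.σ (Sum.inr f))).trans (congrArg P.old h),
      (P.addCircle_σ_old (Sum.inr (P.e f))).trans (congrArg P.old h.σ_e), P.addCircle_σ_old y,
      (P.addCircle_σ_old (P.σ y)).trans (congrArg P.old hy2), P.addCircle_σ_new false,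
      P.addCircle_σ_new true]
  -- Subdividing `P.attach f y` at `y`, and the reversal of `P.attach f (σ y)` at `σ y`, gives the
  -- same pre-graph up to exchanging the edge `{f, e f}` with the new edge.
  let φ : Perm (P.F ⊕ Bool) := exchange (Sum.inl f) (Sum.inr true) *
    exchange (Sum.inl (P.e f)) (Sum.inr false)
  let η : Fin 4 ↪ P.F ⊕ Bool :=
    ⟨![Sum.inl f, Sum.inl (P.e f), Sum.inr true, Sum.inr false],
      List.nodup_ofFn.mp (by simp [(P.e_ne f).symm])⟩
  have hφη : φ = (swap 0 2 * swap 1 3 : Perm (Fin 4)).viaEmbedding η := by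
    rw [viaEmbedding_mul]
    exact congrArg₂ (· * ·) (exchange_eq_viaEmbedding η 0 2) (exchange_eq_viaEmbedding η 1 3)
  have hφe : φ * Perm.sumCongr P.e Equiv.boolNot = Perm.sumCongr P.e Equiv.boolNot * φ := by
    rw [hφη]
    refine viaEmbedding_mul_comm η (Perm.sumCongr P.e Equiv.boolNot) (swap 0 1 * swap 2 3) _ (fun i => Or.inr ?_)
      (by decide)
    fin_cases i
    exacts [rfl, congrArg Sum.inl (P.e_e f), rfl, rfl]
  have hφθ : Perm.sumCongr (1 : Perm X) φ = (swap 0 6 * swap 2 5 : Perm (Fin 7)).viaEmbedding θ := by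
    have h1 : Perm.sumCongr (1 : Perm X) φ =
        Perm.sumCongr 1 (exchange (Sum.inl f) (Sum.inr true)) *
          Perm.sumCongr 1 (exchange (Sum.inl (P.e f)) (Sum.inr false)) := by
      rw [Perm.sumCongr_mul]
      rfl
    rw [h1, sumCongr_exchange, sumCongr_exchange, viaEmbedding_mul]
    exact congrArg₂ (· * ·) (exchange_eq_viaEmbedding θ 0 6) (exchange_eq_viaEmbedding θ 2 5)
  have e1 : diagram R (P.attach f y) = diagram R (P.addCircle.rearrange
      ((swap 3 5 * swap 0 3 : Perm (Fin 7)).viaEmbedding θ)) := by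
    refine (diagram_subdivide R (P.attach f y) y).symm.trans (congrArg (diagram R) ?_)
    refine (P.subdivide_rearrange _ _).trans (congrArg P.addCircle.rearrange ?_)
    rw [viaEmbedding_mul, exchange_viaEmbedding]
    exact congrArg₂ (· * ·) (exchange_eq_viaEmbedding θ 3 5) (exchange_eq_viaEmbedding θ 0 3)
  have e2 : - diagram R (P.attach f (P.σ y)) = diagram R (P.addCircle.rearrange
      ((swap 4 5 * (swap 0 4 * swap 0 1) : Perm (Fin 7)).viaEmbedding θ)) := by
    have ht : P.IsTrivalentAt (Sum.inr f) := by
      unfold IsTrivalentAt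
      rw [show P.σ (P.σ (Sum.inr f)) = Sum.inr (P.e f) from h]
      exact fun h' => P.e_ne f (Sum.inr_injective h')
    refine (diagram_rearrange_mul_exchange R P _ _ ht).symm.trans ?_
    refine (diagram_subdivide R (P.rearrange _) (P.σ y)).symm.trans (congrArg (diagram R) ?_)
    refine (P.subdivide_rearrange _ _).trans (congrArg P.addCircle.rearrange ?_)
    rw [viaEmbedding_mul, viaEmbedding_mul, viaEmbedding_mul, exchange_viaEmbedding,
      exchange_viaEmbedding]
    exact congrArg₂ (· * ·) (exchange_eq_viaEmbedding θ 4 5)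
      (congrArg₂ (· * ·) (exchange_eq_viaEmbedding θ 0 4) (exchange_eq_viaEmbedding θ 0 1))
  have hiso := P.addCircle.iso_sumCongr_mul
    ((swap 3 5 * swap 0 3 : Perm (Fin 7)).viaEmbedding θ) φ hφe
  let ψ : Perm (X ⊕ P.addCircle.F) := Perm.sumCongr 1 φ
  have hψ : ψ = (swap 0 6 * swap 2 5 : Perm (Fin 7)).viaEmbedding θ := hφθ
  have he : P.addCircle.rearrange (ψ * (swap 3 5 * swap 0 3 : Perm (Fin 7)).viaEmbedding θ) =
      P.addCircle.rearrange
        ((swap 4 5 * (swap 0 4 * swap 0 1) : Perm (Fin 7)).viaEmbedding θ) := by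
    rw [hψ, ← viaEmbedding_mul]
    exact P.addCircle.rearrange_congr (viaEmbedding_conj θ P.addCircle.σ _ _ _
      (fun i => Or.inr (hθ i)) (by decide))
  rw [← eq_neg_iff_add_eq_zero, e1, e2, diagram_eq_of_iso R hiso, he]

/-- For a diagram `T` inside a larger one, the sum over all legs of `T` of the diagrams obtained
by attaching a free leg from outside to this leg of `T` vanishes. The sum of the corresponding
diagrams over all half-edges of `T` is zero because the sum at each vertex is zero, and the two
half-edges of an edge inside `T` cancel. -/
theorem sum_diagram_attach_eq_zero {Φ : PreGraph Y → PreGraph X} (L : Local Φ) (T : PreGraph Y)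
    [Fintype Y] {f : (Φ T).F} (h : (Φ T).IsTadpole f) (hf : ∀ x, L.j T x ≠ Sum.inr f) :
    ∑ y : Y, diagram R ((Φ T).attach f (L.j T (Sum.inl y))) = 0 := by
  classical
  have := T.finite_F
  have := Fintype.ofFinite T.F
  have hjσ : ∀ x, L.j T (T.σ.symm x) = (Φ T).σ.symm (L.j T x) := fun x => by
    rw [Equiv.eq_symm_apply, L.σ_j, Equiv.apply_symm_apply]
  have hoff : ∀ x, (Φ T).OffTadpole f (L.j T x) := by
    intro x
    have h2 : ∀ x, L.j T x ≠ (Φ T).σ (Sum.inr f) := by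
      intro x h'
      apply hf (T.σ.symm x)
      rw [hjσ, h', Equiv.symm_apply_apply]
    refine ⟨hf x, h2 x, fun h' => h2 (T.σ.symm x) ?_⟩
    rw [hjσ, h', Equiv.symm_apply_eq]
    exact h.symm
  have hall : ∑ x : Y ⊕ T.F, diagram R ((Φ T).attach f (L.j T x)) = 0 := by
    refine T.orbits.sum_eq_zero _ (fun x hx => ?_) fun x hx => ?_
    · have h2 := diagram_attach_bivalent R h (hoff x) (by rw [L.σ_j, L.σ_j, hx])
      rwa [L.σ_j] at h2
    · have h3 := diagram_attach_trivalent R h (hoff x) (L.trivalent T x hx)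
      rwa [L.σ_j, L.σ_j] at h3
  have hin : ∑ g : T.F, diagram R ((Φ T).attach f (L.j T (Sum.inr g))) = 0 := by
    refine Finset.sum_involution (fun g _ => T.e g) (fun g _ => ?_)
      (fun g _ _ => T.e_ne g) (fun _ _ => Finset.mem_univ _) fun g _ => T.e_e g
    have h1 := hoff (Sum.inr g)
    have h2 := hoff (Sum.inr (T.e g))
    rw [L.j_inr, ← L.e_k] at h2
    rw [L.j_inr] at h1
    rw [L.j_inr, L.j_inr, ← L.e_k]
    exact diagram_attach_e R h h1 h2
  rwa [Fintype.sum_sum_type, hin, add_zero] at hall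

end Attach

/-! ### Insertion into a rearranged graph -/

section Insertion

open PreGraph Equiv

variable {X : Type*}

namespace PreGraph

namespace Vertex

variable {D : PreGraph X}

/-- A vertex of `D` after the half-edges of `D` have been rearranged. -/
def rearrange (v : D.Vertex) (τ : Perm (X ⊕ D.F)) : (D.rearrange τ).Vertex where
  carrier := τ '' v.carrier
  isOrbit := by
    obtain ⟨x, hx, hv⟩ := v.isOrbit
    refine ⟨τ x, D.isTrivalentAt_rearrange τ hx, ?_⟩
    rw [rearrange_σ, rearrange_σ, hv]
    exact (Set.image_insert_eq).trans (congrArg _ (Set.image_pair _ _ _))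

/-- The numbering of the half-edges of a rearranged vertex. -/
noncomputable def rearrangeNumbering (v : D.Vertex) (π : Fin 3 ≃ v.carrier)
    (τ : Perm (X ⊕ D.F)) : Fin 3 ≃ (v.rearrange τ).carrier :=
  π.trans (τ.image v.carrier)

theorem trivalent_of_mem (v : D.Vertex) {x : X ⊕ D.F} (hx : x ∈ v.carrier) :
    D.IsTrivalentAt x := by
  obtain ⟨y, hy, hv⟩ := v.isOrbit
  have h3 : D.σ (D.σ (D.σ y)) = y := (D.orbits y).2.resolve_left hy
  unfold IsTrivalentAt at *
  rw [hv] at hx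
  rcases hx with rfl | rfl | rfl
  · exact hy
  · rw [h3]
    exact (D.orbits y).1.symm
  · rw [h3]
    exact (D.orbits _).1.symm

theorem σ_mem (v : D.Vertex) {x : X ⊕ D.F} (hx : x ∈ v.carrier) : D.σ x ∈ v.carrier := by
  by_contra h
  exact (v.mem_iff x).1 h hx

theorem carrier_eq (v : D.Vertex) {x : X ⊕ D.F} (hx : x ∈ v.carrier) :
    v.carrier = {x, D.σ x, D.σ (D.σ x)} := by
  have h3 : D.σ (D.σ (D.σ x)) = x := (D.orbits x).2.resolve_left (v.trivalent_of_mem hx)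
  obtain ⟨y, hy, hv⟩ := v.isOrbit
  have h3' : D.σ (D.σ (D.σ y)) = y := (D.orbits y).2.resolve_left hy
  rw [hv] at hx ⊢
  rcases hx with rfl | rfl | rfl
  · rfl
  · rw [h3']
    ext z
    simp only [Set.mem_insert_iff, Set.mem_singleton_iff]
    tauto
  · rw [h3']
    ext z
    simp only [Set.mem_insert_iff, Set.mem_singleton_iff]
    tauto

theorem eq_of_mem {u v : D.Vertex} {x : X ⊕ D.F} (hu : x ∈ u.carrier) (hv : x ∈ v.carrier) :
    u = v := by
  have h := (u.carrier_eq hu).trans (v.carrier_eq hv).symm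
  cases u
  cases v
  subst h
  rfl

/-- The vertex at a half-edge. -/
def ofHalfEdge (x : X ⊕ D.F) (hx : D.IsTrivalentAt x) : D.Vertex :=
  ⟨{x, D.σ x, D.σ (D.σ x)}, x, hx, rfl⟩

theorem exists_isCyclic (v : D.Vertex) : ∃ π : Fin 3 ≃ v.carrier, v.IsCyclic π := by
  obtain ⟨x, hx, hv⟩ := v.isOrbit
  have h3 : D.σ (D.σ (D.σ x)) = x := (D.orbits x).2.resolve_left hx
  let g : Fin 3 → v.carrier := ![⟨x, by simp [hv]⟩, ⟨D.σ x, by simp [hv]⟩,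
    ⟨D.σ (D.σ x), by simp [hv]⟩]
  have hinj : Function.Injective g := List.nodup_ofFn.mp (by
    simp [g, (D.orbits x).1.symm, Ne.symm hx, (D.orbits (D.σ x)).1.symm])
  have hsur : Function.Surjective g := by
    rintro ⟨y, hy⟩
    rw [hv] at hy
    rcases hy with rfl | rfl | rfl
    exacts [⟨0, rfl⟩, ⟨1, rfl⟩, ⟨2, rfl⟩]
  refine ⟨Equiv.ofBijective g ⟨hinj, hsur⟩, fun i => ?_⟩
  fin_cases i
  exacts [rfl, rfl, h3]

/-- A cyclic numbering can be rotated so that it starts with a given half-edge. -/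
theorem exists_isCyclic_of_mem (v : D.Vertex) {x : X ⊕ D.F} (hx : x ∈ v.carrier) :
    ∃ π : Fin 3 ≃ v.carrier, v.IsCyclic π ∧ (π 0 : X ⊕ D.F) = x := by
  obtain ⟨π, hπ⟩ := v.exists_isCyclic
  refine ⟨(Equiv.addRight (π.symm ⟨x, hx⟩)).trans π, fun i => ?_, ?_⟩
  · have h : i + 1 + π.symm ⟨x, hx⟩ = i + π.symm ⟨x, hx⟩ + 1 := by abel
    simp only [Equiv.trans_apply, Equiv.coe_addRight, h]
    exact hπ _
  · simp

end Vertex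

/-- The half-edges of `D` as half-edges of a pre-graph obtained by insertion into `D`. -/
def outer (D : PreGraph X) (F : Type) : X ⊕ D.F ↪ X ⊕ (D.F ⊕ F) :=
  ⟨Sum.map id Sum.inl, Function.Injective.sumMap Function.injective_id Sum.inl_injective⟩

variable {D : PreGraph X}

theorem outer_ne_inner {F : Type} (x : X ⊕ D.F) (f : F) :
    D.outer F x ≠ Sum.inr (Sum.inr f) := by
  rcases x with x | x <;> simp [outer]

theorem glue_inl (v : D.Vertex) (π : Fin 3 ≃ v.carrier) (F : Type)
    (x : {x : X ⊕ D.F // x ∉ v.carrier}) : v.glue π F (Sum.inl x) = D.outer F x := by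
  obtain ⟨x | x, hx⟩ := x <;> simp [Vertex.glue, Vertex.split, outer]

theorem glue_leg (v : D.Vertex) (π : Fin 3 ≃ v.carrier) (F : Type) (i : Fin 3) :
    v.glue π F (Sum.inr (Sum.inl i)) = D.outer F (π i) := by
  have h : v.split π (Sum.inr i) = π i := by simp [Vertex.split]
  simp only [Vertex.glue, Equiv.trans_apply, Equiv.sumAssoc_symm_apply_inr_inl,
    Equiv.sumCongr_apply, Sum.map_inl, h]
  rcases (π i : X ⊕ D.F) with y | y <;> rfl

theorem glue_inner (v : D.Vertex) (π : Fin 3 ≃ v.carrier) (F : Type) (f : F) :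
    v.glue π F (Sum.inr (Sum.inr f)) = Sum.inr (Sum.inr f) := by
  simp [Vertex.glue]

theorem plug_σ_outer (v : D.Vertex) (π : Fin 3 ≃ v.carrier) (T : PreGraph (Fin 3))
    {x : X ⊕ D.F} (hx : x ∉ v.carrier) :
    (plug v π T).σ (D.outer T.F x) = D.outer T.F (D.σ x) :=
  (congrArg _ (glue_inl v π T.F ⟨x, hx⟩).symm).trans
    ((plug_σ v π T (Sum.inl ⟨x, hx⟩)).trans (glue_inl v π T.F (v.rest ⟨x, hx⟩)))

/-- The half-edges of `D` as half-edges of the pre-graph obtained by inserting `T` at `v`. -/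
def plugOuter (v : D.Vertex) (π : Fin 3 ≃ v.carrier) (T : PreGraph (Fin 3)) :
    X ⊕ D.F ↪ X ⊕ (plug v π T).F :=
  D.outer T.F

/-- Rearranging the half-edges of `D` and then inserting `T` is the same as inserting `T` and then
rearranging the half-edges which come from `D`. -/
theorem plug_rearrange_vertex_σ (v : D.Vertex) (π : Fin 3 ≃ v.carrier) (τ : Perm (X ⊕ D.F))
    (T : PreGraph (Fin 3)) : (plug (v.rearrange τ) (v.rearrangeNumbering π τ) T).σ =
      τ.viaEmbedding (plugOuter v π T) * (plug v π T).σ *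
        (τ.viaEmbedding (plugOuter v π T))⁻¹ := by
  have hout : ∀ x, τ.viaEmbedding (D.outer T.F) (D.outer T.F x) = D.outer T.F (τ x) :=
    Perm.viaEmbedding_apply τ (D.outer T.F)
  have hin : ∀ y, τ.viaEmbedding (D.outer T.F) (v.glue π T.F (Sum.inr y)) =
      (v.rearrange τ).glue (v.rearrangeNumbering π τ) T.F (Sum.inr y) := by
    rintro (i | f)
    · rw [glue_leg, hout]
      exact (glue_leg (v.rearrange τ) (v.rearrangeNumbering π τ) T.F i).symm
    · rw [glue_inner, Perm.viaEmbedding_apply_of_notMem]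
      · exact (glue_inner (v.rearrange τ) (v.rearrangeNumbering π τ) T.F f).symm
      · rintro ⟨x, hx⟩
        exact outer_ne_inner x f hx
  refine eq_conj_of_apply fun x => ?_
  obtain ⟨y, rfl⟩ := (v.glue π T.F).surjective x
  rcases y with ⟨y, hy⟩ | y
  · have hy' : τ y ∉ (v.rearrange τ).carrier := fun h => hy (τ.injective.mem_set_image.1 h)
    rw [glue_inl]
    refine (congrArg _ (hout y)).trans ?_
    refine (plug_σ_outer (v.rearrange τ) (v.rearrangeNumbering π τ) T hy').trans ?_
    refine (congrArg ((D.rearrange τ).outer T.F) (D.rearrange_σ τ y)).trans ?_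
    exact (hout _).symm.trans (congrArg _ (plug_σ_outer v π T hy).symm)
  · refine (congrArg _ (hin y)).trans ?_
    refine (plug_σ (v.rearrange τ) (v.rearrangeNumbering π τ) T (Sum.inr y)).trans ?_
    exact (hin (T.σ y)).symm.trans (congrArg _ (plug_σ v π T (Sum.inr y)).symm)

/-- Relabelling the legs before an insertion changes the numbering of the half-edges. -/
theorem plug_relabel (v : D.Vertex) (π : Fin 3 ≃ v.carrier) (s : Perm (Fin 3))
    (T : PreGraph (Fin 3)) : plug v π (T.relabel s) = plug v (s.trans π) T := by
  have hg : ∀ y, v.glue π T.F (Sum.inr (relabelHalfEdge s T y)) =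
      v.glue (s.trans π) T.F (Sum.inr y) := by
    rintro (i | f)
    · exact (glue_leg v π T.F (s i)).trans (glue_leg v (s.trans π) T.F i).symm
    · exact (glue_inner v π T.F f).trans (glue_inner v (s.trans π) T.F f).symm
  have key : (plug v π (T.relabel s)).σ = (plug v (s.trans π) T).σ := by
    refine Equiv.ext fun x => ?_
    obtain ⟨y, rfl⟩ := (v.glue (s.trans π) T.F).surjective x
    rcases y with ⟨y, hy⟩ | y
    · rw [glue_inl]
      exact (plug_σ_outer v π (T.relabel s) hy).trans (plug_σ_outer v (s.trans π) T hy).symm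
    · refine (congrArg _ (hg y).symm).trans ?_
      refine (plug_σ v π (T.relabel s) (Sum.inr (relabelHalfEdge s T y))).trans ?_
      refine (congrArg (fun z => v.glue π T.F (Sum.inr z)) (relabel_σ s T y)).trans ?_
      exact (hg _).trans (plug_σ v (s.trans π) T (Sum.inr y)).symm
  exact mk_congr key

/-- Rearranging the half-edges at the vertex before an insertion changes their numbering. -/
theorem plug_swap_σ (v : D.Vertex) (π : Fin 3 ≃ v.carrier) (T : PreGraph (Fin 3))
    (i j : Fin 3) : (plug v ((swap i j).trans π) T).σ =
      exchange (plugOuter v π T (π i)) (plugOuter v π T (π j)) * (plug v π T).σ *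
        (exchange (plugOuter v π T (π i)) (plugOuter v π T (π j)))⁻¹ := by
  classical
  have hleg : ∀ y, exchange (D.outer T.F (π i)) (D.outer T.F (π j)) (v.glue π T.F (Sum.inr y)) =
      v.glue ((swap i j).trans π) T.F (Sum.inr y) := by
    rintro (k | f)
    · rw [glue_leg, glue_leg, ← map_exchange (D.outer T.F).injective,
        ← map_exchange Subtype.val_injective, ← map_exchange π.injective, exchange_eq_swap]
      rfl
    · rw [glue_inner, glue_inner, exchange_eq_swap]
      apply swap_apply_of_ne_of_ne
      · exact (outer_ne_inner (π i : X ⊕ D.F) f).symm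
      · exact (outer_ne_inner (π j : X ⊕ D.F) f).symm
  have hout : ∀ y ∉ v.carrier, exchange (D.outer T.F (π i)) (D.outer T.F (π j)) (D.outer T.F y) =
      D.outer T.F y := by
    intro y hy
    rw [exchange_eq_swap]
    refine swap_apply_of_ne_of_ne ?_ ?_
    · exact (D.outer T.F).injective.ne fun h => hy (h ▸ (π i).2)
    · exact (D.outer T.F).injective.ne fun h => hy (h ▸ (π j).2)
  refine eq_conj_of_apply fun x => ?_
  obtain ⟨y, rfl⟩ := (v.glue π T.F).surjective x
  rcases y with ⟨y, hy⟩ | y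
  · rw [glue_inl]
    refine (congrArg _ (hout y hy)).trans ?_
    refine (plug_σ_outer v ((swap i j).trans π) T hy).trans ?_
    exact (hout _ (fun h => (v.mem_iff y).2 hy h)).symm.trans
      (congrArg _ (plug_σ_outer v π T hy).symm)
  · refine (congrArg _ (hleg y)).trans ?_
    refine (plug_σ v ((swap i j).trans π) T (Sum.inr y)).trans ?_
    exact (hleg _).symm.trans (congrArg _ (plug_σ v π T (Sum.inr y)).symm)

end PreGraph

variable (R : Type*) [CommRing R] {D : PreGraph X}

theorem psi_diagram (v : D.Vertex) (π : Fin 3 ≃ v.carrier) (T : PreGraph (Fin 3)) :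
    psi R v π (diagram R T) = diagram R (plug v π T) :=
  psi_mk R v π T

theorem psi_relabelMap (v : D.Vertex) (π : Fin 3 ≃ v.carrier) (s : Perm (Fin 3))
    (T : DiagramModule R (Fin 3)) : psi R v π (relabelMap R s T) = psi R v (s.trans π) T := by
  have h : psi R v π ∘ₗ relabelMap R s = psi R v (s.trans π) := by
    refine linearMap_ext_diagram R fun P => ?_
    rw [LinearMap.comp_apply, relabelMap_diagram, psi_diagram, psi_diagram, plug_relabel]
  exact LinearMap.congr_fun h T

theorem psi_trans_of_mem_Lam (v : D.Vertex) (π : Fin 3 ≃ v.carrier) (s : Perm (Fin 3))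
    {T : DiagramModule R (Fin 3)} (hT : T ∈ Lam R) :
    psi R v (s.trans π) T = ((Perm.sign s : ℤˣ) : ℤ) • psi R v π T := by
  rw [← psi_relabelMap, (mem_Lam R T).1 hT s, map_zsmul]

theorem psi_eq_of_isCyclic (v : D.Vertex) {π π' : Fin 3 ≃ v.carrier} (hπ : v.IsCyclic π)
    (hπ' : v.IsCyclic π') {T : DiagramModule R (Fin 3)} (hT : T ∈ Lam R) :
    psi R v π T = psi R v π' T := by
  have hs : ∀ s : Perm (Fin 3), (∀ i, s (i + 1) = s i + 1) → Perm.sign s = 1 := by decide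
  have hπs : π = (π.trans π'.symm).trans π' := by
    ext i
    simp
  rw [hπs, psi_trans_of_mem_Lam R v π' _ hT, hs]
  · simp
  · intro i
    apply π'.injective
    apply Subtype.val_injective
    simp only [Equiv.trans_apply, Equiv.apply_symm_apply]
    rw [← hπ i, ← hπ', Equiv.apply_symm_apply]

end Insertion

/-! ### Insertion at one of two adjacent vertices -/

section Adjacent

open PreGraph Equiv

variable {X : Type*}

/-- The linear algebra of the argument.  The permutation `ρ` stands for the tree with two vertices
which carry the half-edges `ρ 0, ρ 1, ρ 2` and `ρ 3, ρ 4, ρ 5`, with an antisymmetric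
element inserted at the first vertex; the half-edges `0` and `3` form the inner edge.  The
hypotheses are the antisymmetry at both vertices, the symmetry between the two ends of the inner
edge, and the vanishing of the sum over the three ways of attaching a fourth leg to the inserted
element.  The last relation, for each of the four legs, expresses the three channels with the
element inserted at either end in terms of each other, and shows that twice the difference between
the two ends vanishes. -/
theorem two_nsmul_eq_of_four_leg_relations {M : Type*} [AddCommGroup M] (K : Perm (Fin 6) → M)
    (h01 : ∀ ρ, K (ρ * swap 0 1) = - K ρ) (h12 : ∀ ρ, K (ρ * swap 1 2) = - K ρ)
    (h34 : ∀ ρ, K (ρ * swap 3 4) = - K ρ) (h45 : ∀ ρ, K (ρ * swap 4 5) = - K ρ)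
    (h03 : ∀ ρ, K (swap 0 3 * ρ) = K ρ)
    (hsum : ∀ ρ : Perm (Fin 6), ρ 3 = 0 → ρ 5 = 3 →
      K (swap 0 (ρ 0) * ρ) + K (swap 0 (ρ 1) * ρ) + K (swap 0 (ρ 2) * ρ) = 0) :
    2 • K 1 = 2 • K (swap 0 3 * (swap 1 4 * swap 2 5)) := by
  let β : Perm (Fin 6) := swap 1 2 * swap 2 4
  have hrel : ∀ ρ : Perm (Fin 6), ρ 0 = 0 → ρ 3 = 3 → K ρ + K (ρ * β) + K (ρ * β⁻¹) = 0 := by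
    intro ρ h0 h3
    -- `t` moves the third leg of the inserted element to the other end of the edge, and
    -- makes the inner edge a loop
    let t : Perm (Fin 6) := swap 0 4 * swap 4 5 * swap 5 3
    have ht : ∀ (u : Perm (Fin 6)) (i : Fin 6),
        swap 0 ((ρ * u) i) * (ρ * u) = ρ * (swap 0 (u i) * u) := by
      intro u i
      have h := Equiv.mul_swap_eq_swap_mul ρ 0 (u i)
      rw [h0] at h
      rw [← mul_assoc, ← mul_assoc, h]
      rfl
    have t0 : swap 0 (t 0) * t = swap 3 4 * swap 4 5 := by decide
    have t1 : swap 0 (t 1) * t = β * swap 1 2 * swap 0 1 * swap 3 4 * swap 4 5 := by decide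
    have t2 : swap 0 (t 2) * t = β⁻¹ * swap 0 1 * swap 1 2 * swap 3 4 * swap 4 5 := by decide
    have h := hsum (ρ * t) (by rw [Perm.mul_apply, show t 3 = 0 by decide, h0])
      (by rw [Perm.mul_apply, show t 5 = 3 by decide, h3])
    rw [ht, ht, ht, t0, t1, t2] at h
    simpa only [← mul_assoc, h01, h12, h34, h45, neg_neg] using h
  let ε : Perm (Fin 6) := swap 1 4 * swap 2 5
  have r1 := hrel 1 rfl rfl
  have r2 := hrel (1 * swap 4 5) (by decide) (by decide)
  have r3 := hrel ε (by decide) (by decide)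
  have r4 := hrel (ε * swap 4 5) (by decide) (by decide)
  rw [show 1 * β = β from one_mul _, show 1 * β⁻¹ = β⁻¹ from one_mul _] at r1
  rw [h45] at r2
  rw [show ε * β = 1 * swap 4 5 * β⁻¹ * swap 4 5 by decide,
    show ε * β⁻¹ = β⁻¹ * swap 1 2 * swap 4 5 by decide, h45, h45, h12, neg_neg] at r3
  rw [h45, show ε * swap 4 5 * β = 1 * swap 4 5 * β * swap 1 2 * swap 4 5 by decide,
    show ε * swap 4 5 * β⁻¹ = β * swap 4 5 by decide, h45, h45, h12, neg_neg] at r4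
  rw [h03]
  change 2 • K 1 = 2 • K ε
  have e1 : K 1 = - K β - K β⁻¹ := by
    rw [← sub_eq_zero, ← r1]
    abel
  have e2 : K 1 = K (1 * swap 4 5 * β) + K (1 * swap 4 5 * β⁻¹) := by
    rw [← sub_eq_zero, ← neg_eq_zero, ← r2]
    abel
  have e3 : K ε = K (1 * swap 4 5 * β⁻¹) - K β⁻¹ := by
    rw [← sub_eq_zero, ← r3]
    abel
  have e4 : K ε = K (1 * swap 4 5 * β) - K β := by
    rw [← sub_eq_zero, ← neg_eq_zero, ← r4]
    abel
  rw [two_nsmul, two_nsmul]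
  nth_rewrite 1 [e1]
  nth_rewrite 1 [e3]
  rw [e2, e4]
  abel

variable (R : Type*) [CommRing R] {D : PreGraph X}

/-- Insertion at the vertex `v` after the half-edges of `D` have been rearranged by `τ`. -/
noncomputable def psiRearranged (v : D.Vertex) (π : Fin 3 ≃ v.carrier) (τ : Perm (X ⊕ D.F)) :
    DiagramModule R (Fin 3) →ₗ[Polynomial R] DiagramModule R X :=
  psi R (v.rearrange τ) (v.rearrangeNumbering π τ)

theorem psiRearranged_diagram (v : D.Vertex) (π : Fin 3 ≃ v.carrier) (τ : Perm (X ⊕ D.F))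
    (T : PreGraph (Fin 3)) : psiRearranged R v π τ (diagram R T) =
      diagram R ((plug v π T).rearrange (τ.viaEmbedding (plugOuter v π T))) :=
  (psi_diagram R (v.rearrange τ) (v.rearrangeNumbering π τ) T).trans
    (congrArg (diagram R) (mk_congr (plug_rearrange_vertex_σ v π τ T)))

theorem psiRearranged_one (v : D.Vertex) (π : Fin 3 ≃ v.carrier) :
    psiRearranged R v π 1 = psi R v π := by
  refine linearMap_ext_diagram R fun T => ?_
  rw [psiRearranged_diagram, psi_diagram, viaEmbedding_one]
  congr 1

theorem psiRearranged_mul_exchange_leg (v : D.Vertex) (π : Fin 3 ≃ v.carrier)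
    (τ : Perm (X ⊕ D.F)) {i j : Fin 3} (hij : i ≠ j) {T : DiagramModule R (Fin 3)}
    (hT : T ∈ Lam R) :
    psiRearranged R v π (τ * exchange (π i : X ⊕ D.F) (π j)) T = - psiRearranged R v π τ T := by
  have h : psiRearranged R v π (τ * exchange (π i : X ⊕ D.F) (π j)) =
      psiRearranged R v ((swap i j).trans π) τ := by
    refine linearMap_ext_diagram R fun P => ?_
    rw [psiRearranged_diagram, psiRearranged_diagram, viaEmbedding_mul, exchange_viaEmbedding]
    exact congrArg (diagram R) (mk_congr (conj_eq_mul_conj _ (plug_swap_σ v π P i j)).symm)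
  rw [h]
  refine (psi_trans_of_mem_Lam R (v.rearrange τ) (v.rearrangeNumbering π τ) (swap i j) hT).trans ?_
  rw [Perm.sign_swap hij]
  simp [psiRearranged]

theorem psiRearranged_mul_exchange_σ (v : D.Vertex) (π : Fin 3 ≃ v.carrier)
    (τ : Perm (X ⊕ D.F)) {x : X ⊕ D.F} (hx : D.IsTrivalentAt x) (hxv : x ∉ v.carrier) :
    psiRearranged R v π (τ * exchange x (D.σ x)) = - psiRearranged R v π τ := by
  refine linearMap_ext_diagram R fun T => ?_
  have hσ := plug_σ_outer v π T hxv
  have ht : (plug v π T).IsTrivalentAt (D.outer T.F x) := by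
    intro h
    refine hx ((D.outer T.F).injective (Eq.trans ?_ h))
    exact ((congrArg _ hσ).trans
      (plug_σ_outer v π T (fun h' => (v.mem_iff x).2 hxv h'))).symm
  rw [LinearMap.neg_apply, psiRearranged_diagram, psiRearranged_diagram, viaEmbedding_mul,
    exchange_viaEmbedding, ← diagram_rearrange_mul_exchange R _ _ _ ht]
  exact congrArg (fun z => diagram R ((plug v π T).rearrange
    (τ.viaEmbedding (plugOuter v π T) * exchange (plugOuter v π T x) z))) hσ.symm

theorem psiRearranged_exchange_edge_mul (v : D.Vertex) (π : Fin 3 ≃ v.carrier)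
    (τ : Perm (X ⊕ D.F)) (f : D.F) :
    psiRearranged R v π (exchange (Sum.inr f) (Sum.inr (D.e f)) * τ) = psiRearranged R v π τ := by
  refine linearMap_ext_diagram R fun T => ?_
  let E : Perm (D.F ⊕ T.F) := Perm.sumCongr D.e T.e
  let φ : Perm (D.F ⊕ T.F) := exchange (Sum.inl f) (Sum.inl (D.e f))
  have hφ : φ * E = E * φ := by
    refine Eq.trans ?_ (exchange_mul E (Sum.inl f) (Sum.inl (D.e f)))
    have h : (E (Sum.inl (D.e f)) : D.F ⊕ T.F) = Sum.inl f := congrArg Sum.inl (D.e_e f)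
    rw [h]
    classical
    simp only [φ, exchange_eq_swap]
    rw [swap_comm]
    rfl
  have hφ1 : Perm.sumCongr (1 : Perm X) φ = (exchange (Sum.inr f)
      (Sum.inr (D.e f))).viaEmbedding (plugOuter v π T) := by
    rw [exchange_viaEmbedding]
    exact sumCongr_exchange (Sum.inl f : D.F ⊕ T.F) (Sum.inl (D.e f))
  rw [psiRearranged_diagram, psiRearranged_diagram, viaEmbedding_mul, ← hφ1]
  exact (diagram_eq_of_iso R ((plug v π T).iso_sumCongr_mul _ φ hφ)).symm

/-- The sum over the legs of the inserted element of the three ways of attaching the free leg of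
a tadpole to them. -/
theorem sum_psiRearranged_eq_zero (v : D.Vertex) (π : Fin 3 ≃ v.carrier) (τ : Perm (X ⊕ D.F))
    {f : D.F} (h : (D.rearrange τ).IsTadpole f) (hf : Sum.inr f ∉ τ '' v.carrier) :
    ∑ i, psiRearranged R v π (exchange (Sum.inr f) (τ (π i)) * τ) = 0 := by
  refine linearMap_ext_diagram R fun T => ?_
  let w := v.rearrange τ
  let κ := v.rearrangeNumbering π τ
  have htad : (plug w κ T).IsTadpole (Sum.inl f : D.F ⊕ T.F) := by
    have h1 := plug_σ_outer w κ T hf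
    have h2 := plug_σ_outer w κ T (fun h' => (w.mem_iff _).2 hf h')
    exact ((congrArg _ h1).trans h2).trans (congrArg ((D.rearrange τ).outer T.F) h)
  have hnot : ∀ x, (plugLocal w κ).j T x ≠ Sum.inr (Sum.inl f) := by
    rintro (i | g) hx
    · refine hf ?_
      have hi : ((D.rearrange τ).outer T.F) (κ i) = (D.rearrange τ).outer T.F (Sum.inr f) :=
        (glue_leg w κ T.F i).symm.trans hx
      have hi' : (κ i : X ⊕ (D.rearrange τ).F) = Sum.inr f :=
        ((D.rearrange τ).outer T.F).injective hi
      exact hi' ▸ (κ i).2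
    · exact Sum.inr_ne_inl (Sum.inr_injective ((glue_inner w κ T.F g).symm.trans hx))
  have hsum := sum_diagram_attach_eq_zero R (plugLocal w κ) T htad hnot
  rw [LinearMap.zero_apply, LinearMap.sum_apply, ← hsum]
  refine Finset.sum_congr rfl fun i _ => ?_
  rw [psiRearranged_diagram, viaEmbedding_mul, exchange_viaEmbedding]
  have hleg : (plugLocal w κ).j T (Sum.inl i) = plugOuter v π T (τ (π i)) := glue_leg w κ T.F i
  unfold attach
  rw [hleg]
  exact congrArg (diagram R)
    (mk_congr (conj_eq_mul_conj _ (plug_rearrange_vertex_σ v π τ T)).symm)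

end Adjacent

/-! ### Independence of the vertex -/

section Transport

open PreGraph Equiv

variable {X : Type*} (R : Type*) [CommRing R] {D : PreGraph X}

/-- If `τ` respects the cyclic orders at all vertices of `D` and sends the vertex `u` to `v`, then
insertion at `u` followed by `τ` is insertion at `v`. -/
theorem psiRearranged_eq_psi {u v : D.Vertex} (πu : Fin 3 ≃ u.carrier) (πv : Fin 3 ≃ v.carrier)
    (τ : Perm (X ⊕ D.F)) (hτ : ∀ x, D.σ (τ x) = τ (D.σ x))
    (h : ∀ i, τ (πu i) = (πv i : X ⊕ D.F)) : psiRearranged R u πu τ = psi R v πv := by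
  refine linearMap_ext_diagram R fun T => ?_
  rw [psiRearranged_diagram, psi_diagram]
  refine congrArg (diagram R) (mk_congr (Eq.symm (eq_conj_of_apply fun x => ?_)))
  have hout : ∀ x, τ.viaEmbedding (plugOuter u πu T) (D.outer T.F x) = D.outer T.F (τ x) :=
    Perm.viaEmbedding_apply τ (D.outer T.F)
  have hin : ∀ y, τ.viaEmbedding (plugOuter u πu T) (u.glue πu T.F (Sum.inr y)) =
      v.glue πv T.F (Sum.inr y) := by
    rintro (i | f)
    · rw [glue_leg]
      exact ((hout _).trans (congrArg _ (h i))).trans (glue_leg v πv T.F i).symm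
    · rw [glue_inner]
      refine (Perm.viaEmbedding_apply_of_notMem _ _ _ ?_).trans (glue_inner v πv T.F f).symm
      rintro ⟨x, hx⟩
      exact outer_ne_inner x f hx
  obtain ⟨y, rfl⟩ := (u.glue πu T.F).surjective x
  rcases y with ⟨y, hy⟩ | y
  · have hy' : τ y ∉ v.carrier := by
      intro hv
      obtain ⟨i, hi⟩ := πv.surjective ⟨τ y, hv⟩
      refine hy ?_
      rw [← τ.injective ((h i).trans (congrArg Subtype.val hi))]
      exact (πu i).2
    rw [glue_inl]
    refine (congrArg _ (hout y)).trans ((plug_σ_outer v πv T hy').trans ?_)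
    rw [hτ]
    exact (hout _).symm.trans (congrArg _ (plug_σ_outer u πu T hy).symm)
  · refine (congrArg _ (hin y)).trans ((plug_σ v πv T (Sum.inr y)).trans ?_)
    exact (hin (T.σ y)).symm.trans (congrArg _ (plug_σ u πu T (Sum.inr y)).symm)

/-- The half-edges at `u` and `v` are numbered by `Fin 6` in such a way that `0` and `3` form the
edge which joins the two vertices; permutations of `Fin 6` then describe all graphs which arise from
`D` by rearranging these half-edges. -/
theorem psi_eq_of_adjacent_of_ne (h2 : IsUnit (2 : R)) {u v : D.Vertex} (huv : u ≠ v)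
    {πu : Fin 3 ≃ u.carrier} {πv : Fin 3 ≃ v.carrier} (hu : u.IsCyclic πu) (hv : v.IsCyclic πv)
    {f : D.F} (hfu : (πu 0 : X ⊕ D.F) = Sum.inr f) (hfv : (πv 0 : X ⊕ D.F) = Sum.inr (D.e f))
    {T : DiagramModule R (Fin 3)} (hT : T ∈ Lam R) : psi R u πu T = psi R v πv T := by
  have hdisj : ∀ i j, (πu i : X ⊕ D.F) ≠ πv j := fun i j h =>
    huv (Vertex.eq_of_mem (πu i).2 (h ▸ (πv j).2))
  have hπu : ∀ i j, (πu i : X ⊕ D.F) = πu j ↔ i = j := fun i j => by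
    rw [Subtype.val_inj, πu.injective.eq_iff]
  have hπv : ∀ i j, (πv i : X ⊕ D.F) = πv j ↔ i = j := fun i j => by
    rw [Subtype.val_inj, πv.injective.eq_iff]
  let θ : Fin 6 ↪ X ⊕ D.F := ⟨![πu 0, πu 1, πu 2, πv 0, πv 1, πv 2],
    List.nodup_ofFn.mp (by simp [hdisj, hπu, hπv])⟩
  have hθv : ∀ i : Fin 6, 3 ≤ i → θ i ∈ v.carrier := by
    intro i hi
    fin_cases i
    exacts [absurd hi (by decide), absurd hi (by decide), absurd hi (by decide),
      (πv 0).2, (πv 1).2, (πv 2).2]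
  have hθvu : ∀ i : Fin 6, 3 ≤ i → θ i ∉ u.carrier := fun i hi h =>
    huv (Vertex.eq_of_mem h (hθv i hi))
  have hσ : ∀ i, D.σ (θ i) =
      θ ((swap 0 1 * swap 1 2 * (swap 3 4 * swap 4 5) : Perm (Fin 6)) i) := by
    intro i
    fin_cases i
    exacts [hu 0, hu 1, hu 2, hv 0, hv 1, hv 2]
  let K : Perm (Fin 6) → DiagramModule R X := fun ρ =>
    psiRearranged R u πu (ρ.viaEmbedding θ) T
  have hleg : ∀ (ρ : Perm (Fin 6)) (i j : Fin 3), i ≠ j →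
      psiRearranged R u πu (ρ.viaEmbedding θ * exchange (πu i : X ⊕ D.F) (πu j)) T = - K ρ :=
    fun ρ i j hij => psiRearranged_mul_exchange_leg R u πu _ hij hT
  have hflip : ∀ (ρ : Perm (Fin 6)) (i : Fin 6), 3 ≤ i →
      psiRearranged R u πu (ρ.viaEmbedding θ * exchange (θ i) (D.σ (θ i))) T = - K ρ := by
    intro ρ i hi
    rw [psiRearranged_mul_exchange_σ R u πu _ (v.trivalent_of_mem (hθv i hi)) (hθvu i hi)]
    rfl
  have key : 2 • K 1 = 2 • K (swap 0 3 * (swap 1 4 * swap 2 5)) := by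
    refine two_nsmul_eq_of_four_leg_relations K (fun ρ => ?_) (fun ρ => ?_) (fun ρ => ?_)
      (fun ρ => ?_) (fun ρ => ?_) (fun ρ h3 h5 => ?_)
    · rw [← hleg ρ 0 1 (by decide)]
      simp only [K]
      rw [viaEmbedding_mul, ← exchange_eq_viaEmbedding θ 0 1]
      rfl
    · rw [← hleg ρ 1 2 (by decide)]
      simp only [K]
      rw [viaEmbedding_mul, ← exchange_eq_viaEmbedding θ 1 2]
      rfl
    · rw [← hflip ρ 3 (by decide), hσ]
      simp only [K]
      rw [viaEmbedding_mul, ← exchange_eq_viaEmbedding θ 3 4]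
      rfl
    · rw [← hflip ρ 4 (by decide), hσ]
      simp only [K]
      rw [viaEmbedding_mul, ← exchange_eq_viaEmbedding θ 4 5]
      rfl
    · have h := psiRearranged_exchange_edge_mul R u πu (ρ.viaEmbedding θ) f
      rw [← hfu, ← hfv] at h
      simp only [K]
      rw [viaEmbedding_mul, ← exchange_eq_viaEmbedding θ 0 3]
      exact LinearMap.congr_fun h T
    · have hf : ρ.viaEmbedding θ (θ 3) = Sum.inr f := by
        rw [Perm.viaEmbedding_apply, h3]
        exact hfu
      have htad : (D.rearrange (ρ.viaEmbedding θ)).IsTadpole f := by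
        refine (congrArg (fun z => (D.rearrange (ρ.viaEmbedding θ)).σ
          ((D.rearrange (ρ.viaEmbedding θ)).σ z)) hf.symm).trans ?_
        rw [rearrange_σ, rearrange_σ, hσ, hσ]
        refine (Perm.viaEmbedding_apply ρ θ 5).trans ?_
        rw [h5]
        exact hfv
      have hnot : Sum.inr f ∉ ρ.viaEmbedding θ '' u.carrier := by
        rw [← hf, (ρ.viaEmbedding θ).injective.mem_set_image]
        exact hθvu 3 le_rfl
      have h := sum_psiRearranged_eq_zero R u πu (ρ.viaEmbedding θ) htad hnot
      have hK : ∀ (i : Fin 3) (j : Fin 6), (πu i : X ⊕ D.F) = θ j →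
          psiRearranged R u πu (exchange (Sum.inr f) (ρ.viaEmbedding θ (πu i)) *
            ρ.viaEmbedding θ) T = K (swap 0 (ρ j) * ρ) := by
        intro i j hij
        rw [hij, Perm.viaEmbedding_apply, ← hfu]
        simp only [K]
        rw [viaEmbedding_mul, ← exchange_eq_viaEmbedding θ 0 (ρ j)]
        rfl
      have h' := LinearMap.congr_fun h T
      rw [LinearMap.sum_apply, Fin.sum_univ_three, hK 0 0 rfl, hK 1 1 rfl, hK 2 2 rfl] at h'
      exact h'
  have hK1 : K 1 = psi R u πu T := by
    simp only [K]
    rw [viaEmbedding_one, psiRearranged_one]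
  have hKv : K (swap 0 3 * (swap 1 4 * swap 2 5)) = psi R v πv T := by
    refine LinearMap.congr_fun (psiRearranged_eq_psi R πu πv _ (fun x => ?_) fun i => ?_) T
    · exact (DFunLike.congr_fun (viaEmbedding_mul_comm θ D.σ _ _ (fun i => Or.inr (hσ i))
        (by decide)) x).symm
    · fin_cases i
      exacts [Perm.viaEmbedding_apply _ θ 0, Perm.viaEmbedding_apply _ θ 1,
        Perm.viaEmbedding_apply _ θ 2]
  have h2' : IsUnit (2 : Polynomial R) := by
    have h := h2.map (Polynomial.C : R →+* Polynomial R)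
    rwa [map_ofNat] at h
  rw [← hK1, ← hKv]
  refine h2'.smul_left_cancel.1 ?_
  simpa only [two_smul, two_nsmul] using key

theorem psi_eq_of_adjacent (h2 : IsUnit (2 : R)) {u v : D.Vertex}
    {πu : Fin 3 ≃ u.carrier} {πv : Fin 3 ≃ v.carrier} (hu : u.IsCyclic πu) (hv : v.IsCyclic πv)
    (huv : u.Adjacent v) {T : DiagramModule R (Fin 3)} (hT : T ∈ Lam R) :
    psi R u πu T = psi R v πv T := by
  by_cases h : u = v
  · subst h
    exact psi_eq_of_isCyclic R u hu hv hT
  · obtain ⟨f, hf, hf'⟩ := huv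
    obtain ⟨πu', hu', h0⟩ := u.exists_isCyclic_of_mem hf
    obtain ⟨πv', hv', h0'⟩ := v.exists_isCyclic_of_mem hf'
    rw [psi_eq_of_isCyclic R u hu hu' hT, psi_eq_of_isCyclic R v hv hv' hT]
    exact psi_eq_of_adjacent_of_ne R h2 h hu' hv' h0 h0' hT

/-- In a graph, bivalent vertices form components of their own, so a path which starts at a
trivalent vertex passes through trivalent vertices only. -/
theorem psi_eq_of_connected (h2 : IsUnit (2 : R)) (hD : D.IsGraph)
    {T : DiagramModule R (Fin 3)} (hT : T ∈ Lam R) {x y : X ⊕ D.F} (h : D.Connected x y) :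
    (D.IsTrivalentAt x ↔ D.IsTrivalentAt y) ∧
      ∀ (u v : D.Vertex) (πu : Fin 3 ≃ u.carrier) (πv : Fin 3 ≃ v.carrier), u.IsCyclic πu →
        v.IsCyclic πv → x ∈ u.carrier → y ∈ v.carrier → psi R u πu T = psi R v πv T := by
  have hbi : ∀ f : D.F, ¬ D.IsTrivalentAt (Sum.inr f) → ¬ D.IsTrivalentAt (Sum.inr (D.e f)) := by
    intro f hf
    have hf' := not_not.1 hf
    rcases hD _ hf' with ⟨a, b, ha, -⟩ | ⟨g, hg, hg'⟩
    · exact absurd ha Sum.inr_ne_inl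
    · obtain rfl := Sum.inr_injective hg
      rw [IsTrivalentAt, not_not, ← hg', hf']
  induction h with
  | rel x y hxy =>
    rcases hxy with rfl | ⟨f, rfl, rfl⟩
    · refine ⟨?_, fun u v πu πv hu hv hx hy => ?_⟩
      · unfold IsTrivalentAt
        rw [D.σ.injective.ne_iff]
      · obtain rfl := Vertex.eq_of_mem (u.σ_mem hx) hy
        exact psi_eq_of_isCyclic R u hu hv hT
    · refine ⟨?_, fun u v πu πv hu hv hx hy => psi_eq_of_adjacent R h2 hu hv ⟨f, hx, hy⟩ hT⟩
      refine not_iff_not.1 ⟨hbi f, fun h => ?_⟩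
      have h' := hbi _ h
      rwa [D.e_e] at h'
  | refl x =>
    refine ⟨Iff.rfl, fun u v πu πv hu hv hx hy => ?_⟩
    obtain rfl := Vertex.eq_of_mem hx hy
    exact psi_eq_of_isCyclic R u hu hv hT
  | symm x y _ ih =>
    exact ⟨ih.1.symm, fun u v πu πv hu hv hx hy => (ih.2 v u πv πu hv hu hy hx).symm⟩
  | trans x y z _ _ ih ih' =>
    refine ⟨ih.1.trans ih'.1, fun u v πu πv hu hv hx hz => ?_⟩
    let w := Vertex.ofHalfEdge y (ih.1.1 (u.trivalent_of_mem hx))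
    have hy : y ∈ w.carrier := Set.mem_insert _ _
    obtain ⟨πw, hw⟩ := w.exists_isCyclic
    exact (ih.2 u w πu πw hu hw hx hy).trans (ih'.2 w v πw πv hw hv hy hz)

end Transport

end Jacobi

theorem mainTheorem3 {R : Type*} [CommRing R] (h2 : IsUnit (2 : R))
    {X : Type*} [Finite X] (D : Jacobi.PreGraph X) (hD : D.IsGraph) :
    (∀ (v : D.Vertex) (π π' : Fin 3 ≃ v.carrier), v.IsCyclic π → v.IsCyclic π' →
      (Jacobi.psi R v π).domRestrict (Jacobi.Lam R) =
        (Jacobi.psi R v π').domRestrict (Jacobi.Lam R)) ∧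
    (∀ (u v : D.Vertex) (πu : Fin 3 ≃ u.carrier) (πv : Fin 3 ≃ v.carrier),
      u.IsCyclic πu → v.IsCyclic πv → u.Adjacent v →
      (Jacobi.psi R v πv).domRestrict (Jacobi.Lam R) =
        (Jacobi.psi R u πu).domRestrict (Jacobi.Lam R)) ∧
    (∀ (u v : D.Vertex) (πu : Fin 3 ≃ u.carrier) (πv : Fin 3 ≃ v.carrier),
      u.IsCyclic πu → v.IsCyclic πv → u.SameComponent v →
      (Jacobi.psi R v πv).domRestrict (Jacobi.Lam R) =
        (Jacobi.psi R u πu).domRestrict (Jacobi.Lam R)) := by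
  refine ⟨fun v π π' hπ hπ' => ?_, fun u v πu πv hu hv huv => ?_, fun u v πu πv hu hv huv => ?_⟩
  · exact LinearMap.ext fun T => Jacobi.psi_eq_of_isCyclic R v hπ hπ' T.2
  · exact LinearMap.ext fun T => (Jacobi.psi_eq_of_adjacent R h2 hu hv huv T.2).symm
  · obtain ⟨x, hx, y, hy, hxy⟩ := huv
    exact LinearMap.ext fun T =>
      ((Jacobi.psi_eq_of_connected R h2 hD T.2 hxy).2 u v πu πv hu hv hx hy).symm
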